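/- Let $N\ge 3$ and $k\in\{1,\dots,N-1\}$. Write $x=(x^{(N-k)},x^{(k)})\in\mathbb R^{N-k}\times\mathbb R^{k}=\mathbb R^N$, let $G_k=O(N-k)\times O(k)\subset O(N)$ act block-diagonally, and call $F:\mathbb S^{N-1}\to\mathbb C$ $G_k$-invariant if $F(A\theta)=F(\theta)$ for all $A\in G_k$, $\theta\in \mathbb S^{N-1}$. Let $\sigma$ be the surface measure on $\mathbb S^{N-1}$ and, for $F\in L^2(\mathbb S^{N-1})$, $$\check F_\sigma(x)=(2\pi)^{-N/2}\int_{\mathbb S^{N-1}}e^{i x\cdot\omega}F(\omega)\,d\sigma(\omega),\qquad x\in\mathbb R^N.$$ For $\alpha\ge\beta>0$ and $a>0$ let $Q$ be the indicator function of $$L_{\alpha,\beta}=\bigl\{x\in\mathbb R^N:\ |x^{(N-k)}|\le a\max\{|x^{(k)}|^{-\alpha},|x^{(k)}|^{-\beta}\}\bigr\}$$ (where $0^{-\alpha}=0^{-\beta}=+\infty$), and for $2\le k\le N-2$ put $$\lambda_{N,k,\alpha,\beta}=\max\Bigl\{\frac{2k-2\beta(N-k)}{k-1},\ \frac{2(N-k)-\frac{2k}{\alpha}}{N-k-1}\Bigr\}.$$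 Consider the following condition on $q$: $$(*)\quad\begin{cases} k=1,\ \ \beta>\frac1{N-1},\ \ q>\dfrac{2(N-1)-\frac2\alpha}{N-2},&\text{or}\\[1mm] 2\le k\le N-2,\ \ q>\lambda_{N,k,\alpha,\beta},&\text{or}\\[1mm] k=N-1,\ \ \alpha<N-1,\ \ q>\dfrac{2(N-1)-2\beta}{N-2}.\end{cases}$$ (i) For all $\alpha\ge\beta>0$ and $a>0$ there is a constant $C=C(N,k,\alpha,\beta,a)$ such that for every real $q\ge1$ satisfying $(*)$ and every $G_k$-invariant $F\in L^2(\mathbb S^{N-1})$, $$\|Q\,\check F_\sigma\|_{L^q(\mathbb R^N)}\le C\,\|F\|_{L^2(\mathbb S^{N-1})}.$$ (ii) If $2\le k\le N-2$ and $\alpha=\beta=\frac{k}{N-k}$, then every $q\ge1$ satisfies $(*)$. (iii) If $\alpha=\beta>0$, $\alpha(N-k)(N-1)>N+1-2k$ and $\alpha\,(2k-(N-1))<k(N-1)$, then some $q\ge 1$ below the Stein–Tomas exponent, $q<\frac{2(N+1)}{N-1}$, satisfies $(*)$. -/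

import Mathlib

open MeasureTheory

noncomputable section

namespace FourierExt

/-- The Euclidean space `ℝ^N`. -/
abbrev Euc (N : ℕ) : Type := EuclideanSpace ℝ (Fin N)

/-- The unit sphere `S^{N-1}` of `ℝ^N`. -/
abbrev Sph (N : ℕ) : Type := Metric.sphere (0 : Euc N) 1

/-- The surface measure on `S^{N-1}` induced by Lebesgue measure. -/
def sigma (N : ℕ) : Measure (Sph N) := (volume : Measure (Euc N)).toSphere

/-- `|x^{(N-k)}|`: the Euclidean norm of the first `N - k` coordinates of `x`. -/
def headNorm (N k : ℕ) (x : Euc N) : ℝ :=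
  √(∑ i : Fin N with i.val < N - k, x i ^ 2)

/-- `|x^{(k)}|`: the Euclidean norm of the last `k` coordinates of `x`. -/
def tailNorm (N k : ℕ) (x : Euc N) : ℝ :=
  √(∑ i : Fin N with N - k ≤ i.val, x i ^ 2)

/-- The action of an orthogonal matrix on `S^{N-1}`. -/
def act {N : ℕ} (A : Matrix.orthogonalGroup (Fin N) ℝ) (θ : Sph N) : Sph N :=
  ⟨WithLp.toLp 2 ((A : Matrix (Fin N) (Fin N) ℝ).mulVec (θ : Euc N).ofLp), by
    have hθ : ‖(θ : Euc N)‖ = 1 := mem_sphere_zero_iff_norm.1 θ.2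
    have hA : (A : Matrix (Fin N) (Fin N) ℝ).transpose * (A : Matrix (Fin N) (Fin N) ℝ) = 1 :=
      (Matrix.mem_orthogonalGroup_iff' _ _).1 A.2
    have key : dotProduct ((A : Matrix (Fin N) (Fin N) ℝ).mulVec (θ : Euc N).ofLp)
        ((A : Matrix (Fin N) (Fin N) ℝ).mulVec (θ : Euc N).ofLp)
        = dotProduct (θ : Euc N).ofLp (θ : Euc N).ofLp := by
      rw [Matrix.dotProduct_mulVec, Matrix.vecMul_mulVec, hA, Matrix.vecMul_one]
    rw [EuclideanSpace.norm_eq] at hθ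
    rw [mem_sphere_zero_iff_norm, EuclideanSpace.norm_eq]
    refine Eq.trans ?_ hθ
    simp only [Real.norm_eq_abs, sq_abs]
    simpa only [dotProduct, pow_two] using congrArg Real.sqrt key⟩

/-- The group `G_k = O(N-k) × O(k)`: orthogonal matrices which are block diagonal with respect to
the first `N - k` and the last `k` coordinates. -/
def blockGroup (N k : ℕ) : Subgroup (Matrix.orthogonalGroup (Fin N) ℝ) where
  carrier := {A | ∀ i j : Fin N, ¬(i.val < N - k ↔ j.val < N - k) →
    (A : Matrix (Fin N) (Fin N) ℝ) i j = 0}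
  one_mem' := by
    intro i j hij
    have : i ≠ j := by rintro rfl; exact hij Iff.rfl
    simp [Matrix.one_apply_ne this]
  mul_mem' := by
    intro A B hA hB i j hij
    simp only [Submonoid.coe_mul, Matrix.mul_apply]
    refine Finset.sum_eq_zero fun l _ => ?_
    by_cases h : (i.val < N - k ↔ l.val < N - k)
    · rw [hB l j (by tauto), mul_zero]
    · rw [hA i l h, zero_mul]
  inv_mem' := by
    intro A hA i j hij
    have h := hA j i (by tauto)
    simpa [Matrix.star_apply] using h

/-- `F` is `G`-invariant: `F (A θ) = F θ` for all `A ∈ G` and all `θ ∈ S^{N-1}`. -/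
def IsInvariant {N : ℕ} (G : Subgroup (Matrix.orthogonalGroup (Fin N) ℝ)) (F : Sph N → ℂ) : Prop :=
  ∀ A ∈ G, ∀ θ : Sph N, F (act A θ) = F θ

/-- The inverse Fourier transform of `F dσ`:
`(2π)^{-N/2} ∫_{S^{N-1}} e^{i x·ω} F(ω) dσ(ω)`. -/
def extension {N : ℕ} (F : Sph N → ℂ) (x : Euc N) : ℂ :=
  (((2 * Real.pi) ^ (-(N : ℝ) / 2) : ℝ) : ℂ) *
    ∫ ω : Sph N, Complex.exp (Complex.I * ((inner ℝ x (ω : Euc N) : ℝ) : ℂ)) * F ω ∂(sigma N)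

/-- The set `L_{α,β}`. Negative powers of `0` are `+∞`, so points with `x^{(k)} = 0` belong to it. -/
def L (N k : ℕ) (α β a : ℝ) : Set (Euc N) :=
  {x | tailNorm N k x = 0 ∨
    headNorm N k x ≤ a * max (tailNorm N k x ^ (-α)) (tailNorm N k x ^ (-β))}

/-- The exponent `λ_{N,k,α,β}` (used for `2 ≤ k ≤ N - 2`). -/
def lam (N k : ℕ) (α β : ℝ) : ℝ :=
  max ((2 * k - 2 * β * (N - k)) / (k - 1)) ((2 * (N - k) - 2 * k / α) / (N - k - 1))

/-- The conditions on `q`. -/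
def ExponentCondition (N k : ℕ) (α β q : ℝ) : Prop :=
  (k = 1 ∧ 1 / ((N : ℝ) - 1) < β ∧ (2 * ((N : ℝ) - 1) - 2 / α) / (N - 2) < q) ∨
  (2 ≤ k ∧ k + 2 ≤ N ∧ lam N k α β < q) ∨
  (k + 1 = N ∧ α < (N : ℝ) - 1 ∧ (2 * ((N : ℝ) - 1) - 2 * β) / (N - 2) < q)

end FourierExt

end

noncomputable section

namespace FourierExt

open scoped ENNReal NNReal ComplexConjugate

/-! The set `L N k α β a` lies in a bounded box together with two arms: one runs along the first `N
- k` coordinates and has width of order `s ^ (-1 / α)` at distance `s`, the other runs along the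
last `k` coordinates and has width of order `s ^ (-β)`. The bounded box is harmless, because the
extension is bounded by the `L²` norm of `F`. An arm is described by a set `p` of `m` long
coordinates, the `κ` remaining short coordinates and a decay exponent `θ`. It is cut dyadically, and
its piece at distance `R = 2 ^ j` lies in a box of size about `R` by `R ^ (-θ)`.

The basic estimate (`exists_lintegral_box_rawExt_sq_le`) bounds the square integral of the extension
over a box of size `R` by `τ` by `R ^ loss κ * τ ^ κ`, up to a constant and the squared norm of `F`.
A Gaussian majorant and Schur's test reduce it to the surface measure of the points of the sphere
whose projection to the long coordinates lies within `1 / R` of a given point. The projected surface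
measure has density proportional to `(1 - |y|²) ^ ((κ - 2) / 2)`. This is bounded for `κ ≥ 2`,
whereas for `κ = 1` its singularity at the boundary costs `R ^ (1 / 2)`.

For `q ≤ 2`, Hölder's inequality with the volume `R ^ (m - κ θ)` of a piece gives a geometric
series. For `q ≥ 2`, invariance supplies pointwise decay (`exists_enorm_rawExt_sq_le_rpow`): the
extension takes equal values on an orbit of dimension `m - 1`, so its square at one point is an
average over a shell of volume about `R ^ (m - 1)`, which the box estimate controls. If `m = 1`, the
conditions on `α` and `β` make the arm have finite volume.

The inequalities needed on the arms have room to spare at the critical exponent. Hence a single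
exponent `q₀` below all admissible `q` can be treated, and the trivial sup bound passes from `q₀` to
every larger `q` with one constant. The assertions about admissible exponents are algebra. -/

/-- The projection of `ℝ^N` onto the coordinates satisfying `p`. -/
def proj {N : ℕ} (p : Fin N → Prop) (x : Euc N) : EuclideanSpace ℝ {i // p i} :=
  WithLp.toLp 2 fun i => x i

/-- The exponent lost in the local `L²` estimate if `k` is the number of remaining directions. -/
def loss (k : ℕ) : ℝ := if k = 1 then 1 / 2 else 0

/-! ### Splitting the space into two coordinate blocks -/

section Proj

variable {N : ℕ} (p : Fin N → Prop)

lemma proj_sub (x y : Euc N) : proj p (x - y) = proj p x - proj p y := by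
  ext i; simp [proj]

lemma proj_smul (c : ℝ) (x : Euc N) : proj p (c • x) = c • proj p x := by
  ext i; simp [proj]

lemma continuous_proj : Continuous (proj p) := by
  unfold proj; fun_prop

variable [DecidablePred p]

lemma norm_proj_sq (x : Euc N) : ‖proj p x‖ ^ 2 = ∑ i with p i, x i ^ 2 := by
  rw [EuclideanSpace.norm_sq_eq, ← Finset.sum_subtype_eq_sum_filter, Finset.subtype_univ]
  simp [proj]

lemma norm_proj_sq_add (x : Euc N) :
    ‖proj p x‖ ^ 2 + ‖proj (fun i => ¬ p i) x‖ ^ 2 = ‖x‖ ^ 2 := by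
  rw [norm_proj_sq, norm_proj_sq, Finset.sum_filter_add_sum_filter_not, EuclideanSpace.norm_sq_eq]
  simp

lemma norm_proj_le (x : Euc N) : ‖proj p x‖ ≤ ‖x‖ := by
  have h := norm_proj_sq_add p x
  exact abs_le_of_sq_le_sq' (by nlinarith [sq_nonneg ‖proj (fun i => ¬ p i) x‖]) (norm_nonneg _) |>.2

lemma measurePreserving_proj_prod :
    MeasurePreserving (fun x : Euc N => (proj p x, proj (fun i => ¬ p i) x))
      volume (volume.prod volume) := by
  have h1 := PiLp.volume_preserving_ofLp (Fin N)
  have h2 := volume_preserving_piEquivPiSubtypeProd (fun _ : Fin N => ℝ) p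
  have h3 := (PiLp.volume_preserving_toLp {i // p i}).prod
    (PiLp.volume_preserving_toLp {i // ¬ p i})
  exact h3.comp (h2.comp h1)

lemma lintegral_proj_prod {f : EuclideanSpace ℝ {i // p i} × EuclideanSpace ℝ {i // ¬ p i} → ℝ≥0∞}
    (hf : Measurable f) :
    ∫⁻ x : Euc N, f (proj p x, proj (fun i => ¬ p i) x) = ∫⁻ y, ∫⁻ z, f (y, z) := by
  rw [(measurePreserving_proj_prod p).lintegral_comp hf, lintegral_prod _ hf.aemeasurable]

end Proj

/-! ### Volumes of thin annuli -/

lemma pow_sub_pow_le_mul_sq_sub_sq {a b : ℝ} (ha : 0 ≤ a) (hab : a ≤ b) (hb : b ≤ 1) {k : ℕ}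
    (hk : 2 ≤ k) : b ^ k - a ^ k ≤ k * (b ^ 2 - a ^ 2) := by
  induction k, hk using Nat.le_induction with
  | base => push_cast; nlinarith
  | succ k hk ih =>
    have h1 : a ^ k ≤ a := by
      simpa using pow_le_pow_of_le_one ha (hab.trans hb) (show 1 ≤ k by omega)
    have h2 : b * (b ^ k - a ^ k) ≤ b ^ k - a ^ k :=
      mul_le_of_le_one_left (sub_nonneg.2 (pow_le_pow_left₀ ha hab k)) hb
    have h3 : a ^ k * (b - a) ≤ a * (b - a) := mul_le_mul_of_nonneg_right h1 (sub_nonneg.2 hab)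
    push_cast
    rw [pow_succ b k, pow_succ a k]
    nlinarith

/-- For `k ≥ 2` the difference of `k`-th powers is controlled linearly by that of squares. For `k =
1` only `(b - a) ^ 2 ≤ b ^ 2 - a ^ 2` is available, and the square root is the sole source of
`loss`. -/
lemma pow_sub_pow_le_rpow {a b R : ℝ} (ha : 0 ≤ a) (hab : a ≤ b) (hb : b ≤ 1) (hR : 1 ≤ R)
    (hab2 : b ^ 2 - a ^ 2 ≤ R⁻¹) {k : ℕ} (hk : 1 ≤ k) :
    b ^ k - a ^ k ≤ k * R ^ (loss k - 1) := by
  have hR0 : 0 < R := by linarith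
  rcases hk.eq_or_lt with rfl | hk
  · have : (b - a) ≤ √(R⁻¹) := Real.le_sqrt_of_sq_le (by nlinarith)
    norm_num [loss]
    rw [Real.sqrt_eq_rpow, Real.inv_rpow hR0.le, ← Real.rpow_neg hR0.le] at this
    norm_num at this
    exact this
  · rw [loss, if_neg (by omega), zero_sub, Real.rpow_neg_one]
    exact (pow_sub_pow_le_mul_sq_sub_sq ha hab hb hk).trans (by gcongr)

lemma exists_volume_annulus_le {ι : Type*} [Fintype ι] (hι : 1 ≤ Fintype.card ι) :
    ∃ C : ℝ≥0, ∀ A B R : ℝ, 1 ≤ R → B ≤ 1 → B - A ≤ R⁻¹ →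
      volume {z : EuclideanSpace ℝ ι | A ≤ ‖z‖ ^ 2 ∧ ‖z‖ ^ 2 < B}
        ≤ C * ENNReal.ofReal (R ^ (loss (Fintype.card ι) - 1)) := by
  set k := Fintype.card ι with hk
  set V := volume (Metric.ball (0 : EuclideanSpace ℝ ι) 1) with hV
  have hVt : V ≠ ∞ := measure_ball_lt_top.ne
  have : Nonempty ι := Fintype.card_pos_iff.1 hι
  refine ⟨k * V.toNNReal, fun A B R hR hB hAB => ?_⟩
  have hR0 : 0 < R := by linarith
  by_cases hE : B ≤ 0 ∨ B ≤ A
  · have : {z : EuclideanSpace ℝ ι | A ≤ ‖z‖ ^ 2 ∧ ‖z‖ ^ 2 < B} = ∅ := by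
      ext z
      simp only [Set.mem_ofPred_eq, Set.mem_empty_iff_false, iff_false, not_and, not_lt]
      intro h
      rcases hE with hE | hE
      · exact hE.trans (sq_nonneg _)
      · exact hE.trans h
    simp [this]
  push Not at hE
  -- A negative `A` makes the annulus a full ball, so the inner radius is truncated at zero.
  set a := √(max A 0)
  set b := √B
  have ha2 : a ^ 2 = max A 0 := Real.sq_sqrt (le_max_right _ _)
  have hb2 : b ^ 2 = B := Real.sq_sqrt hE.1.le
  have hab : a ≤ b := Real.sqrt_le_sqrt (max_le hE.2.le hE.1.le)
  have hb1 : b ≤ 1 := Real.sqrt_le_one.2 hB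
  have hsub : {z : EuclideanSpace ℝ ι | A ≤ ‖z‖ ^ 2 ∧ ‖z‖ ^ 2 < B} ⊆
      Metric.ball 0 b \ Metric.ball 0 a := by
    rintro z ⟨h1, h2⟩
    simp only [Set.mem_sdiff, Metric.mem_ball, dist_zero_right, not_lt]
    exact ⟨Real.lt_sqrt_of_sq_lt h2, Real.sqrt_le_iff.2 ⟨norm_nonneg _, max_le h1 (sq_nonneg _)⟩⟩
  have hdiff : b ^ 2 - a ^ 2 ≤ R⁻¹ := by
    rw [ha2, hb2]; linarith [le_max_left A 0]
  refine (measure_mono hsub).trans ?_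
  rw [measure_sdiff (Metric.ball_subset_ball hab) measurableSet_ball.nullMeasurableSet
    measure_ball_lt_top.ne, Measure.addHaar_ball _ _ (Real.sqrt_nonneg _),
    Measure.addHaar_ball _ _ (Real.sqrt_nonneg _), ← ENNReal.sub_mul (fun _ _ => hVt),
    ← ENNReal.ofReal_sub _ (by positivity), finrank_euclideanSpace]
  calc ENNReal.ofReal (b ^ k - a ^ k) * V
      ≤ ENNReal.ofReal (k * R ^ (loss k - 1)) * V := by
        gcongr
        exact pow_sub_pow_le_rpow (Real.sqrt_nonneg _) hab hb1 hR hdiff hι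
    _ = _ := by
        rw [ENNReal.ofReal_mul (by positivity), ENNReal.ofReal_natCast]
        push_cast
        rw [ENNReal.coe_toNNReal hVt]
        ring

/-! ### Polar coordinates -/

lemma lintegral_polar {N : ℕ} (hN : 1 ≤ N) {f : Euc N → ℝ≥0∞} (hf : Measurable f) :
    ∫⁻ x, f x = ∫⁻ q : Sph N × Set.Ioi (0 : ℝ), f ((q.2 : ℝ) • (q.1 : Euc N))
      ∂((sigma N).prod (Measure.volumeIoiPow (N - 1))) := by
  have : Nonempty (Fin N) := ⟨⟨0, hN⟩⟩
  have h := (volume : Measure (Euc N)).measurePreserving_homeomorphUnitSphereProd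
  rw [finrank_euclideanSpace, Fintype.card_fin] at h
  change _ = ∫⁻ q : Sph N × Set.Ioi (0 : ℝ), f ((q.2 : ℝ) • (q.1 : Euc N))
      ∂(((volume : Measure (Euc N)).toSphere).prod (Measure.volumeIoiPow (N - 1)))
  rw [← h.lintegral_comp (by fun_prop)]
  have : ∀ x : ({0}ᶜ : Set (Euc N)), (f (((homeomorphUnitSphereProd (Euc N) x).2 : ℝ) •
      ((homeomorphUnitSphereProd (Euc N) x).1 : Euc N))) = f x := by
    intro x
    congr 1
    simpa using smul_inv_smul₀ (norm_ne_zero_iff.2 x.2) (x : Euc N)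
  simp_rw [this]
  rw [lintegral_subtype_comap (measurableSet_singleton _).compl (fun x => f x),
    restrict_compl_singleton]

lemma le_volumeIoiPow_Ico {N : ℕ} (hN : 1 ≤ N) {r : ℝ} (hr : 0 < r) (hr1 : r < 1) :
    ENNReal.ofReal (r / N) ≤
      Measure.volumeIoiPow (N - 1) {ρ : Set.Ioi (0 : ℝ) | 1 - r ≤ (ρ : ℝ) ∧ (ρ : ℝ) < 1} := by
  have h : {ρ : Set.Ioi (0 : ℝ) | 1 - r ≤ (ρ : ℝ) ∧ (ρ : ℝ) < 1} =
      Set.Iio ⟨1, Set.mem_Ioi.2 one_pos⟩ \ Set.Iio ⟨1 - r, Set.mem_Ioi.2 (by linarith)⟩ := by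
    ext ρ
    simp only [Set.mem_ofPred_eq, Set.mem_sdiff, Set.mem_Iio, not_lt, ← Subtype.coe_lt_coe,
      and_comm]
  have hN' : ((N - 1 : ℕ) : ℝ) + 1 = N := by rw [Nat.cast_sub hN]; simp
  have hle : (1 - r) ^ N ≤ 1 - r := by
    simpa using pow_le_pow_of_le_one (by linarith) (by linarith : 1 - r ≤ 1) hN
  rw [h, measure_sdiff (Set.Iio_subset_Iio (by rw [← Subtype.coe_le_coe]; simp [hr.le]))
    measurableSet_Iio.nullMeasurableSet (by simp [Measure.volumeIoiPow_apply_Iio]),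
    Measure.volumeIoiPow_apply_Iio, Measure.volumeIoiPow_apply_Iio, ← ENNReal.ofReal_sub _
      (by simp only; have : 0 ≤ 1 - r := by linarith
          positivity), hN', Nat.sub_add_cancel hN, one_pow, ← sub_div]
  gcongr
  linarith

/-! ### Gaussian integrals over the sphere -/

lemma lintegral_gaussian_translate {ι : Type*} [Fintype ι] {b : ℝ} (hb : 0 < b)
    (ξ : EuclideanSpace ℝ ι) :
    ∫⁻ y, ENNReal.ofReal (Real.exp (-(b * ‖y - ξ‖ ^ 2))) =
      ENNReal.ofReal ((Real.pi / b) ^ (Fintype.card ι / 2 : ℝ)) := by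
  rw [lintegral_sub_right_eq_self (fun y => ENNReal.ofReal (Real.exp (-(b * ‖y‖ ^ 2)))) ξ]
  have h := GaussianFourier.integral_rexp_neg_mul_sq_norm (V := EuclideanSpace ℝ ι) hb
  simp only [neg_mul] at h
  have hpos : 0 < (Real.pi / b) ^ (Module.finrank ℝ (EuclideanSpace ℝ ι) / 2 : ℝ) := by positivity
  rw [← ofReal_integral_eq_lintegral_ofReal _ (ae_of_all _ fun _ => (Real.exp_pos _).le), h,
    finrank_euclideanSpace]
  by_contra hni
  rw [integral_undef hni] at h
  exact hpos.ne h

lemma measurableSet_le_and_lt {α : Type*} [MeasurableSpace α] {f g h l : α → ℝ}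
    (hf : Measurable f) (hg : Measurable g) (hh : Measurable h) (hl : Measurable l) :
    MeasurableSet {x | f x ≤ g x ∧ h x < l x} :=
  (measurableSet_le hf hg).inter (measurableSet_lt hh hl)

/-- The sphere is thickened to an annulus of width of order `1 / R`, on which the Gaussian barely
changes radially. Fubini in the two blocks then leaves a full Gaussian integral in `y`, of order `R
^ (-m)`, times the volume of a thin annulus in `z`. Dividing by the thickness restores the surface
measure. -/
lemma exists_lintegral_sphere_gaussian_le {N : ℕ} (p : Fin N → Prop) [DecidablePred p]
    (hp : 1 ≤ Fintype.card {i // ¬ p i}) :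
    ∃ C : ℝ≥0, ∀ R : ℝ, 1 ≤ R → ∀ ξ : EuclideanSpace ℝ {i // p i},
      ∫⁻ ω : Sph N, ENNReal.ofReal (Real.exp (-(R ^ 2 / 4 * ‖proj p ω - ξ‖ ^ 2))) ∂(sigma N)
        ≤ C * ENNReal.ofReal
          (R ^ (loss (Fintype.card {i // ¬ p i}) - Fintype.card {i // p i})) := by
  set k := Fintype.card {i // ¬ p i}
  set m := Fintype.card {i // p i}
  have hN : 1 ≤ N := by
    obtain ⟨i⟩ := Fintype.card_pos_iff.1 hp
    have := i.1.2
    omega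
  obtain ⟨C, hC⟩ := exists_volume_annulus_le hp
  refine ⟨(2 * N * Real.exp 1 * (8 * Real.pi) ^ (m / 2 : ℝ)).toNNReal * C, fun R hR ξ => ?_⟩
  have hR0 : 0 < R := by linarith
  -- With this width the squared radii fill an interval of length at most `2 * r = R⁻¹`, while a
  -- radial move changes `R * ‖proj p ω - ξ‖` by at most `1 / 2`.
  set r := (2 * R)⁻¹ with hr
  have hRr : R * r = 1 / 2 := by rw [hr]; field_simp
  have hr0 : 0 < r := by positivity
  have hr1 : r < 1 := by nlinarith
  set G : Sph N → ℝ≥0∞ := fun ω =>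
    ENNReal.ofReal (Real.exp (-(R ^ 2 / 4 * ‖proj p ω - ξ‖ ^ 2))) with hG
  -- Halving the rate `R ^ 2 / 4` absorbs the cross term produced by the radial move; what remains
  -- is covered by the factor `Real.exp 1`.
  set g : EuclideanSpace ℝ {i // p i} → ℝ≥0∞ := fun y =>
    ENNReal.ofReal (Real.exp (-(R ^ 2 / 8 * ‖y - ξ‖ ^ 2))) with hg
  set T : Set (EuclideanSpace ℝ {i // p i} × EuclideanSpace ℝ {i // ¬ p i}) :=
    {w | (1 - r) ^ 2 ≤ ‖w.1‖ ^ 2 + ‖w.2‖ ^ 2 ∧ ‖w.1‖ ^ 2 + ‖w.2‖ ^ 2 < 1} with hT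
  have hTm : MeasurableSet T := by
    rw [hT]
    exact measurableSet_le_and_lt (by fun_prop) (by fun_prop) (by fun_prop) (by fun_prop)
  set f := T.indicator (fun w => g w.1) with hf
  have hgm : Measurable g := by fun_prop
  have hfm : Measurable f := (hgm.comp measurable_fst).indicator hTm
  have hGm : Measurable G := by
    have := continuous_proj p
    fun_prop
  set I : Set (Set.Ioi (0 : ℝ)) := {ρ | 1 - r ≤ (ρ : ℝ) ∧ (ρ : ℝ) < 1} with hI
  have hIm : MeasurableSet I := by
    rw [hI]
    exact measurableSet_le_and_lt (by fun_prop) (by fun_prop) (by fun_prop) (by fun_prop)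
  have hupper : ∫⁻ x : Euc N, f (proj p x, proj (fun i => ¬ p i) x) ≤
      ENNReal.ofReal ((Real.pi / (R ^ 2 / 8)) ^ (m / 2 : ℝ)) *
        (C * ENNReal.ofReal (R ^ (loss k - 1))) := by
    rw [lintegral_proj_prod p hfm, ← lintegral_gaussian_translate (by positivity) ξ,
      ← lintegral_mul_const _ (by fun_prop)]
    refine lintegral_mono fun y => ?_
    have hfy : ∀ z, f (y, z) = Set.indicator
        {z | (1 - r) ^ 2 - ‖y‖ ^ 2 ≤ ‖z‖ ^ 2 ∧ ‖z‖ ^ 2 < 1 - ‖y‖ ^ 2} (fun _ => g y) z := by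
      intro z
      simp only [hf, Set.indicator_apply, hT, Set.mem_ofPred_eq, sub_le_iff_le_add',
        lt_sub_iff_add_lt']
    simp_rw [hfy]
    have hzm : MeasurableSet {z : EuclideanSpace ℝ {i // ¬ p i} |
        (1 - r) ^ 2 - ‖y‖ ^ 2 ≤ ‖z‖ ^ 2 ∧ ‖z‖ ^ 2 < 1 - ‖y‖ ^ 2} :=
      measurableSet_le_and_lt (by fun_prop) (by fun_prop) (by fun_prop) (by fun_prop)
    rw [lintegral_indicator_const hzm]
    gcongr
    refine hC _ _ R hR (by nlinarith [sq_nonneg ‖y‖]) ?_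
    have : R⁻¹ = 2 * r := by rw [hr]; field_simp
    nlinarith
  have hlower : (∫⁻ ω, G ω ∂(sigma N)) * ENNReal.ofReal (r / N) ≤
      ENNReal.ofReal (Real.exp 1) * ∫⁻ x : Euc N, f (proj p x, proj (fun i => ¬ p i) x) := by
    have hc1 := continuous_proj p
    have hc2 := continuous_proj (fun i => ¬ p i)
    have hfc : Measurable fun x : Euc N => f (proj p x, proj (fun i => ¬ p i) x) :=
      hfm.comp (hc1.prodMk hc2).measurable
    have hfq : Measurable fun q : Sph N × Set.Ioi (0 : ℝ) =>
        f (proj p ((q.2 : ℝ) • (q.1 : Euc N)), proj (fun i => ¬ p i) ((q.2 : ℝ) • (q.1 : Euc N))) :=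
      hfc.comp (by fun_prop)
    rw [lintegral_polar hN hfc, ← lintegral_const_mul _ hfq]
    calc (∫⁻ ω, G ω ∂(sigma N)) * ENNReal.ofReal (r / N)
        ≤ (∫⁻ ω, G ω ∂(sigma N)) * ∫⁻ ρ, I.indicator 1 ρ ∂(Measure.volumeIoiPow (N - 1)) := by
          rw [lintegral_indicator_one hIm]
          gcongr
          exact le_volumeIoiPow_Ico hN hr0 hr1
      _ = ∫⁻ q : Sph N × Set.Ioi (0 : ℝ), G q.1 * I.indicator 1 q.2
            ∂((sigma N).prod (Measure.volumeIoiPow (N - 1))) := by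
          have : IsFiniteMeasure (sigma N) := by unfold sigma; infer_instance
          rw [lintegral_prod_mul hGm.aemeasurable (measurable_one.indicator hIm).aemeasurable]
      _ ≤ _ := by
          refine lintegral_mono fun q => ?_
          by_cases hq : q.2 ∈ I
          swap
          · simp [hq]
          obtain ⟨ω, ρ⟩ := q
          have hω : ‖(ω : Euc N)‖ = 1 := mem_sphere_zero_iff_norm.1 ω.2
          have hρ0 : (0 : ℝ) < ρ := ρ.2
          have hmem : (proj p ((ρ : ℝ) • (ω : Euc N)), proj (fun i => ¬ p i) ((ρ : ℝ) • (ω : Euc N)))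
              ∈ T := by
            simp only [hT, Set.mem_ofPred_eq, norm_proj_sq_add, norm_smul, hω, mul_one,
              Real.norm_eq_abs, sq_abs]
            exact ⟨pow_le_pow_left₀ (by linarith) hq.1 2,
              (sq_lt_one_iff₀ hρ0.le).2 hq.2⟩
          simp only [hf, Set.indicator_of_mem hmem, Set.indicator_of_mem hq, Pi.one_apply, mul_one,
            hG, hg, ← ENNReal.ofReal_mul (Real.exp_pos 1).le, ← Real.exp_add]
          refine ENNReal.ofReal_le_ofReal (Real.exp_le_exp.2 ?_)
          have hD : ‖proj p ((ρ : ℝ) • (ω : Euc N)) - ξ‖ ≤ ‖proj p (ω : Euc N) - ξ‖ + r := by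
            have h1 : proj p ((ρ : ℝ) • (ω : Euc N)) - ξ =
                (proj p (ω : Euc N) - ξ) - (1 - (ρ : ℝ)) • proj p (ω : Euc N) := by
              rw [proj_smul]; module
            rw [h1]
            refine (norm_sub_le _ _).trans ?_
            gcongr
            rw [norm_smul, Real.norm_eq_abs, abs_of_nonneg (by linarith [hq.2])]
            have h2 := norm_proj_le p (ω : Euc N)
            rw [hω] at h2
            have h3 := hq.1
            have h4 := hq.2
            simp only at h3 h4
            nlinarith [norm_nonneg (proj p (ω : Euc N))]
          set D := ‖proj p (ω : Euc N) - ξ‖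
          set D' := ‖proj p ((ρ : ℝ) • (ω : Euc N)) - ξ‖
          have hD0 : 0 ≤ D' := norm_nonneg _
          have h5 : R * D' ≤ R * D + 1 / 2 := by
            rw [← hRr, ← mul_add]; gcongr
          have h6 : (R * D') ^ 2 ≤ (R * D + 1 / 2) ^ 2 :=
            pow_le_pow_left₀ (by positivity) h5 2
          nlinarith [sq_nonneg (R * D - 1 / 2)]
  have hfin := hlower.trans (mul_le_mul_right hupper _)
  have hrN : 0 < r / N := by positivity
  calc ∫⁻ ω, G ω ∂(sigma N)
      = ENNReal.ofReal (N / r) * ((∫⁻ ω, G ω ∂(sigma N)) * ENNReal.ofReal (r / N)) := by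
        rw [mul_comm (∫⁻ ω, G ω ∂(sigma N)), ← mul_assoc, ← ENNReal.ofReal_mul (by positivity),
          div_mul_div_cancel₀ hr0.ne', div_self (by positivity), ENNReal.ofReal_one, one_mul]
    _ ≤ ENNReal.ofReal (N / r) * _ := mul_le_mul_right hfin _
    _ = ENNReal.ofReal (N / r * (Real.exp 1 * ((Real.pi / (R ^ 2 / 8)) ^ (m / 2 : ℝ) *
          R ^ (loss k - 1)))) * C := by
        rw [ENNReal.ofReal_mul (by positivity), ENNReal.ofReal_mul (by positivity),
          ENNReal.ofReal_mul (by positivity)]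
        ring
    _ = ENNReal.ofReal (2 * N * Real.exp 1 * (8 * Real.pi) ^ (m / 2 : ℝ) *
          R ^ (loss k - m)) * C := by
        congr 2
        have h1 : Real.pi / (R ^ 2 / 8) = (8 * Real.pi) * (R ^ (-2 : ℝ)) := by
          rw [Real.rpow_neg hR0.le]; norm_num; field_simp
        have h2 : R ^ (loss k - m) = R * R ^ (-2 * (m / 2 : ℝ)) * R ^ (loss k - 1) := by
          nth_rw 2 [← Real.rpow_one R]
          rw [← Real.rpow_add hR0, ← Real.rpow_add hR0]
          congr 1; ring
        rw [h1, Real.mul_rpow (by positivity) (by positivity), ← Real.rpow_mul hR0.le, h2, hr]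
        field_simp
    _ = _ := by
        rw [ENNReal.ofReal_mul (by positivity)]
        push_cast [ENNReal.ofReal]
        ring

/-! ### The extension operator -/

instance (N : ℕ) : IsFiniteMeasure (sigma N) := by unfold sigma; infer_instance

/-- The extension operator without its normalising factor. -/
def rawExt {N : ℕ} (F : Sph N → ℂ) (x : Euc N) : ℂ :=
  ∫ ω : Sph N, Complex.exp (Complex.I * ((inner ℝ x (ω : Euc N) : ℝ) : ℂ)) * F ω ∂(sigma N)

section Extension

variable {N : ℕ}

lemma norm_exp_I_mul_ofReal (t : ℝ) : ‖Complex.exp (Complex.I * (t : ℂ))‖ = 1 := by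
  rw [mul_comm, Complex.norm_exp_ofReal_mul_I]

lemma enorm_extension_le (F : Sph N → ℂ) (x : Euc N) : ‖extension F x‖ₑ ≤ ‖rawExt F x‖ₑ := by
  unfold extension
  rw [enorm_mul]
  refine mul_le_of_le_one_left (zero_le) ?_
  rw [← ofReal_norm, ENNReal.ofReal_le_one, Complex.norm_real, Real.norm_eq_abs,
    abs_of_nonneg (by positivity)]
  refine Real.rpow_le_one_of_one_le_of_nonpos (by nlinarith [Real.pi_gt_three]) ?_
  have : (0 : ℝ) ≤ N := N.cast_nonneg
  linarith

lemma exists_enorm_rawExt_le (N : ℕ) : ∃ C : ℝ≥0, ∀ F : Sph N → ℂ, MemLp F 2 (sigma N) →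
    ∀ x, ‖rawExt F x‖ₑ ≤ C * eLpNorm F 2 (sigma N) := by
  have h : (sigma N) Set.univ ^ (1 / 2 : ℝ) ≠ ∞ := by finiteness
  refine ⟨((sigma N) Set.univ ^ (1 / 2 : ℝ)).toNNReal, fun F hF x => ?_⟩
  rw [ENNReal.coe_toNNReal h]
  calc ‖rawExt F x‖ₑ ≤ ∫⁻ ω, ‖Complex.exp (Complex.I * ((inner ℝ x (ω : Euc N) : ℝ) : ℂ)) * F ω‖ₑ
        ∂(sigma N) := enorm_integral_le_lintegral_enorm _
    _ = eLpNorm F 1 (sigma N) := by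
        rw [eLpNorm_one_eq_lintegral_enorm]
        congr with ω
        rw [enorm_mul, ← ofReal_norm (Complex.exp _), norm_exp_I_mul_ofReal]
        simp
    _ ≤ eLpNorm F 2 (sigma N) *
          (sigma N) Set.univ ^ (1 / (1 : ℝ≥0∞).toReal - 1 / (2 : ℝ≥0∞).toReal) :=
        eLpNorm_le_eLpNorm_mul_rpow_measure_univ (by norm_num) hF.1
    _ = _ := by
        rw [mul_comm]; norm_num

lemma integrable_exp_mul {F : Sph N → ℂ} (hF : MemLp F 2 (sigma N)) (x : Euc N) :
    Integrable (fun ω : Sph N => Complex.exp (Complex.I * ((inner ℝ x (ω : Euc N) : ℝ) : ℂ)) * F ω)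
      (sigma N) := by
  refine (hF.integrable (by norm_num)).bdd_mul (c := 1) (by fun_prop) (ae_of_all _ fun ω => ?_)
  rw [norm_exp_I_mul_ofReal]

lemma continuous_rawExt {F : Sph N → ℂ} (hF : MemLp F 2 (sigma N)) : Continuous (rawExt F) := by
  refine continuous_of_dominated (bound := fun ω => ‖F ω‖)
    (fun x => (integrable_exp_mul hF x).aestronglyMeasurable) (fun x => ae_of_all _ fun ω => ?_)
    (hF.integrable (by norm_num)).norm (ae_of_all _ fun ω => by fun_prop)
  rw [norm_mul, norm_exp_I_mul_ofReal, one_mul]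

lemma integrable_gaussian {b : Fin N → ℝ} (hb : ∀ i, 0 < b i) :
    Integrable (fun x : Euc N => (Real.exp (-∑ i, b i * x i ^ 2) : ℂ)) := by
  rw [← (PiLp.volume_preserving_toLp (Fin N)).integrable_comp_emb
    (MeasurableEquiv.toLp 2 _).measurableEmbedding]
  have h := GaussianFourier.integrable_cexp_neg_sum_mul_add (b := fun i => (b i : ℂ))
    (fun i => by simpa using hb i) 0
  convert! h using 2 with v
  simp

lemma integral_gaussian_mul_exp {b : Fin N → ℝ} (hb : ∀ i, 0 < b i) (ξ : Euc N) :
    ∫ x : Euc N, (Real.exp (-∑ i, b i * x i ^ 2) : ℂ) *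
        Complex.exp (Complex.I * ((inner ℝ x ξ : ℝ) : ℂ)) =
      ((∏ i, √(Real.pi / b i) * Real.exp (-(ξ i ^ 2 / (4 * b i))) : ℝ) : ℂ) := by
  rw [← (PiLp.volume_preserving_toLp (Fin N)).integral_comp
    (MeasurableEquiv.toLp 2 _).measurableEmbedding]
  have h := GaussianFourier.integral_cexp_neg_sum_mul_add (b := fun i => (b i : ℂ))
    (fun i => by simpa using hb i) (fun i => Complex.I * (ξ i : ℂ))
  convert! h using 1
  · congr with v
    rw [Complex.ofReal_exp, ← Complex.exp_add]
    congr 1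
    simp [PiLp.inner_apply, Finset.mul_sum]
    ring_nf
  · push_cast
    congr with i
    congr 1
    · rw [Real.sqrt_eq_rpow, Complex.ofReal_cpow (div_nonneg Real.pi_pos.le (hb i).le)]
      simp
    · rw [mul_pow, Complex.I_sq]
      ring_nf

/-- Kernel bound for the Gaussian-weighted `L²` norm of the extension operator. -/
lemma lintegral_rawExt_sq_mul_gaussian_le {b : Fin N → ℝ} (hb : ∀ i, 0 < b i) {F : Sph N → ℂ}
    (hF : MemLp F 2 (sigma N)) :
    ∫⁻ x, ‖rawExt F x‖ₑ ^ 2 * ENNReal.ofReal (Real.exp (-∑ i, b i * x i ^ 2)) ≤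
      ∫⁻ q : Sph N × Sph N, ‖F q.1‖ₑ * ‖F q.2‖ₑ * ENNReal.ofReal (∏ i, √(Real.pi / b i) *
        Real.exp (-((q.1 - q.2 : Euc N) i ^ 2 / (4 * b i)))) ∂((sigma N).prod (sigma N)) := by
  set g : Euc N → ℂ := fun x => (Real.exp (-∑ i, b i * x i ^ 2) : ℂ) with hg
  set H : Euc N × (Sph N × Sph N) → ℂ := fun z =>
    Complex.exp (Complex.I * ((inner ℝ z.1 ((z.2.1 : Euc N) - z.2.2) : ℝ) : ℂ)) *
      (g z.1 * (F z.2.1 * conj (F z.2.2))) with hH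
  have hF1 := hF.integrable (by norm_num : (1 : ℝ≥0∞) ≤ 2)
  have hF2 : Integrable (fun ω => conj (F ω)) (sigma N) :=
    Complex.conjCLE.integrable_comp_iff.2 hF1
  have hint : Integrable H (volume.prod ((sigma N).prod (sigma N))) := by
    refine ((integrable_gaussian hb).mul_prod (hF1.mul_prod hF2)).bdd_mul (c := 1) (by fun_prop)
      (ae_of_all _ fun z => ?_)
    rw [norm_exp_I_mul_ofReal]
  have hx : ∀ x, ∫ q, H (x, q) ∂((sigma N).prod (sigma N)) =
      ((‖rawExt F x‖ ^ 2 * Real.exp (-∑ i, b i * x i ^ 2) : ℝ) : ℂ) := by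
    intro x
    have h1 : ∀ q : Sph N × Sph N, H (x, q) = g x *
        ((Complex.exp (Complex.I * ((inner ℝ x (q.1 : Euc N) : ℝ) : ℂ)) * F q.1) *
          conj (Complex.exp (Complex.I * ((inner ℝ x (q.2 : Euc N) : ℝ) : ℂ)) * F q.2)) := by
      intro q
      have : Complex.exp (Complex.I * ((inner ℝ x ((q.1 : Euc N) - q.2) : ℝ) : ℂ)) =
          Complex.exp (Complex.I * ((inner ℝ x (q.1 : Euc N) : ℝ) : ℂ)) *
          conj (Complex.exp (Complex.I * ((inner ℝ x (q.2 : Euc N) : ℝ) : ℂ))) := by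
        rw [← Complex.exp_conj, ← Complex.exp_add, inner_sub_right]
        congr 1
        simp
        ring
      simp only [hH, this, map_mul]
      ring
    simp_rw [h1]
    rw [integral_const_mul, integral_prod_mul
      (fun ω : Sph N => Complex.exp (Complex.I * ((inner ℝ x (ω : Euc N) : ℝ) : ℂ)) * F ω)
      (fun ω : Sph N => conj (Complex.exp (Complex.I * ((inner ℝ x (ω : Euc N) : ℝ) : ℂ)) * F ω)),
      integral_conj]
    change g x * (rawExt F x * conj (rawExt F x)) = _
    rw [Complex.mul_conj, Complex.normSq_eq_norm_sq]
    simp only [hg]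
    push_cast
    ring
  have hq : ∀ q : Sph N × Sph N, ∫ x, H (x, q) = (F q.1 * conj (F q.2)) * ((∏ i, √(Real.pi / b i) *
        Real.exp (-((q.1 - q.2 : Euc N) i ^ 2 / (4 * b i))) : ℝ) : ℂ) := by
    intro q
    rw [← integral_gaussian_mul_exp hb, ← integral_const_mul]
    congr with x
    simp only [hH, hg]
    ring
  have hintx : Integrable (fun x => ‖rawExt F x‖ ^ 2 * Real.exp (-∑ i, b i * x i ^ 2)) := by
    have := hint.integral_prod_left
    simp_rw [hx] at this
    exact Complex.reCLM.integrable_comp this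
  calc ∫⁻ x, ‖rawExt F x‖ₑ ^ 2 * ENNReal.ofReal (Real.exp (-∑ i, b i * x i ^ 2))
      = ∫⁻ x, ENNReal.ofReal (‖rawExt F x‖ ^ 2 * Real.exp (-∑ i, b i * x i ^ 2)) := by
        congr with x
        rw [ENNReal.ofReal_mul (by positivity), ENNReal.ofReal_pow (norm_nonneg _),
          ofReal_norm]
    _ = ENNReal.ofReal (∫ x, ‖rawExt F x‖ ^ 2 * Real.exp (-∑ i, b i * x i ^ 2)) :=
        (ofReal_integral_eq_lintegral_ofReal hintx (ae_of_all _ fun x => by positivity)).symm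
    _ = ‖∫ x, ∫ q, H (x, q) ∂((sigma N).prod (sigma N))‖ₑ := by
        simp_rw [hx]
        rw [integral_complex_ofReal, ← ofReal_norm, Complex.norm_real, Real.norm_eq_abs,
          abs_of_nonneg (integral_nonneg fun x => by positivity)]
    _ = ‖∫ q, (∫ x, H (x, q)) ∂((sigma N).prod (sigma N))‖ₑ := by
        rw [integral_integral_swap hint]
    _ ≤ _ := by
        refine (enorm_integral_le_lintegral_enorm _).trans (le_of_eq ?_)
        congr with q
        rw [hq, enorm_mul, enorm_mul, RCLike.enorm_conj, ← ofReal_norm (Complex.ofReal _),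
          Complex.norm_real, Real.norm_eq_abs, abs_of_nonneg
            (Finset.prod_nonneg fun i _ => by positivity)]

/-- Schur's test. -/
lemma lintegral_mul_mul_kernel_le {α : Type*} [MeasurableSpace α] {μ : Measure α}
    [SFinite μ] {f : α → ℝ≥0∞} (hf : AEMeasurable f μ) {K : α → α → ℝ≥0∞}
    (hK : Measurable (Function.uncurry K)) (hsymm : ∀ a b, K a b = K b a) {M : ℝ≥0∞}
    (hM : ∀ a, ∫⁻ b, K a b ∂μ ≤ M) :
    ∫⁻ q, f q.1 * f q.2 * K q.1 q.2 ∂(μ.prod μ) ≤ 2 * M * ∫⁻ a, f a ^ 2 ∂μ := by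
  have hf1 : AEMeasurable (fun q : α × α => f q.1 ^ 2 * K q.1 q.2) (μ.prod μ) :=
    (hf.comp_fst.pow_const 2).mul hK.aemeasurable
  have hf2 : AEMeasurable (fun q : α × α => f q.2 ^ 2 * K q.1 q.2) (μ.prod μ) :=
    (hf.comp_snd.pow_const 2).mul hK.aemeasurable
  have h1 : ∫⁻ q, f q.1 ^ 2 * K q.1 q.2 ∂(μ.prod μ) ≤ M * ∫⁻ a, f a ^ 2 ∂μ := by
    rw [lintegral_prod _ hf1, ← lintegral_const_mul'' _ (hf.pow_const 2)]
    refine lintegral_mono fun a => ?_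
    have hKa : Measurable (K a) := hK.comp measurable_prodMk_left
    dsimp only
    rw [lintegral_const_mul _ hKa, mul_comm]
    gcongr
    exact hM a
  have h2 : ∫⁻ q, f q.2 ^ 2 * K q.1 q.2 ∂(μ.prod μ) ≤ M * ∫⁻ a, f a ^ 2 ∂μ := by
    rw [← lintegral_prod_swap]
    simpa only [Prod.fst_swap, Prod.snd_swap, hsymm] using h1
  -- The product of two values is at most the square of the larger, hence at most the sum of the
  -- squares. This crude bound is where the factor 2 comes from.
  calc ∫⁻ q, f q.1 * f q.2 * K q.1 q.2 ∂(μ.prod μ)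
      ≤ ∫⁻ q, (f q.1 ^ 2 * K q.1 q.2 + f q.2 ^ 2 * K q.1 q.2) ∂(μ.prod μ) := by
        refine lintegral_mono fun q => ?_
        rw [← add_mul]
        gcongr
        rcases le_total (f q.1) (f q.2) with h | h
        · exact (mul_le_mul_left h _).trans (by rw [← pow_two]; exact le_add_self)
        · exact (mul_le_mul_right h _).trans (by rw [← pow_two]; exact le_self_add)
    _ ≤ M * ∫⁻ a, f a ^ 2 ∂μ + M * ∫⁻ a, f a ^ 2 ∂μ := by
        rw [lintegral_add_left' hf1]
        gcongr
    _ = _ := by ring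

end Extension

/-! ### Estimates on boxes -/

/-- The product of the ball of radius `R` in the coordinates satisfying `p` and the ball of radius
`τ` in the other coordinates. -/
def box {N : ℕ} (p : Fin N → Prop) [DecidablePred p] (R τ : ℝ) : Set (Euc N) :=
  {x | ‖proj p x‖ ≤ R ∧ ‖proj (fun i => ¬ p i) x‖ ≤ τ}

section Box

variable {N : ℕ} (p : Fin N → Prop) [DecidablePred p]

lemma measurableSet_box (R τ : ℝ) : MeasurableSet (box p R τ) :=
  .inter (measurableSet_le (continuous_proj p).norm.measurable measurable_const)
    (measurableSet_le (continuous_proj fun i => ¬ p i).norm.measurable measurable_const)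

lemma exists_volume_box_le : ∃ C : ℝ≥0, ∀ R τ : ℝ, 0 ≤ R → 0 ≤ τ → volume (box p R τ) ≤
    C * ENNReal.ofReal (R ^ Fintype.card {i // p i} * τ ^ Fintype.card {i // ¬ p i}) := by
  set V := volume (Metric.closedBall (0 : EuclideanSpace ℝ {i // p i}) 1)
  set W := volume (Metric.closedBall (0 : EuclideanSpace ℝ {i // ¬ p i}) 1)
  have hV : V ≠ ∞ := measure_closedBall_lt_top.ne
  have hW : W ≠ ∞ := measure_closedBall_lt_top.ne
  refine ⟨V.toNNReal * W.toNNReal, fun R τ hR hτ => ?_⟩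
  have h : box p R τ = (fun x : Euc N => (proj p x, proj (fun i => ¬ p i) x)) ⁻¹'
      (Metric.closedBall 0 R ×ˢ Metric.closedBall 0 τ) := by
    ext x; simp [box]
  rw [h, (measurePreserving_proj_prod p).measure_preimage
    (measurableSet_closedBall.prod measurableSet_closedBall).nullMeasurableSet, Measure.prod_prod,
    Measure.addHaar_closedBall' _ _ hR, Measure.addHaar_closedBall' _ _ hτ,
    finrank_euclideanSpace, finrank_euclideanSpace, ENNReal.ofReal_mul (by positivity)]
  push_cast
  rw [ENNReal.coe_toNNReal hV, ENNReal.coe_toNNReal hW]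
  exact le_of_eq (by ring)

lemma sum_ite_mul_sq (a b : ℝ) (x : Euc N) : ∑ i, (if p i then a else b) * x i ^ 2 =
    a * ‖proj p x‖ ^ 2 + b * ‖proj (fun i => ¬ p i) x‖ ^ 2 := by
  rw [norm_proj_sq, norm_proj_sq, Finset.mul_sum, Finset.mul_sum, ← Finset.sum_ite]
  simp only [ite_mul]

/-- A Gaussian adapted to the box dominates its indicator up to `Real.exp 2`. The resulting kernel
has height `R ^ m * τ ^ k` and decays at scale `1 / R` in the projected variable, so Schur's test
costs only its integral over the sphere. -/
lemma exists_lintegral_box_rawExt_sq_le (hp : 1 ≤ Fintype.card {i // ¬ p i}) :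
    ∃ C : ℝ≥0, ∀ F : Sph N → ℂ, MemLp F 2 (sigma N) → ∀ R τ : ℝ, 1 ≤ R → 0 < τ →
      ∫⁻ x in box p R τ, ‖rawExt F x‖ₑ ^ 2 ≤ C * ENNReal.ofReal
        (R ^ loss (Fintype.card {i // ¬ p i}) * τ ^ Fintype.card {i // ¬ p i}) *
          eLpNorm F 2 (sigma N) ^ 2 := by
  set k := Fintype.card {i // ¬ p i} with hk
  set m := Fintype.card {i // p i} with hm
  obtain ⟨C, hC⟩ := exists_lintegral_sphere_gaussian_le p hp
  refine ⟨(Real.exp 2 * √Real.pi ^ m * √Real.pi ^ k).toNNReal * 2 * C, fun F hF R τ hR hτ => ?_⟩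
  have hR0 : 0 < R := by linarith
  set b : Fin N → ℝ := fun i => if p i then (R ^ 2)⁻¹ else (τ ^ 2)⁻¹ with hb
  have hb0 : ∀ i, 0 < b i := fun i => by simp only [hb]; split_ifs <;> positivity
  have hprod : ∏ i, √(Real.pi / b i) = √Real.pi ^ m * √Real.pi ^ k * (R ^ m * τ ^ k) := by
    have : ∀ i, √(Real.pi / b i) = if p i then √Real.pi * R else √Real.pi * τ := by
      intro i
      simp only [hb]
      split_ifs
      · rw [div_inv_eq_mul, Real.sqrt_mul Real.pi_pos.le, Real.sqrt_sq hR0.le]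
      · rw [div_inv_eq_mul, Real.sqrt_mul Real.pi_pos.le, Real.sqrt_sq hτ.le]
    simp_rw [this]
    rw [Finset.prod_ite, Finset.prod_const, Finset.prod_const, ← Fintype.card_subtype,
      ← Fintype.card_subtype, ← hk, ← hm, mul_pow, mul_pow]
    ring
  set A := √Real.pi ^ m * √Real.pi ^ k with hA
  set K : Sph N → Sph N → ℝ≥0∞ := fun ω η => ENNReal.ofReal (A * (R ^ m * τ ^ k)) *
    ENNReal.ofReal (Real.exp (-(R ^ 2 / 4 * ‖proj p (ω : Euc N) - proj p (η : Euc N)‖ ^ 2)))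
    with hK
  have hKm : Measurable (Function.uncurry K) := by
    have := continuous_proj p
    simp only [hK, Function.uncurry_def]
    fun_prop
  have hKle : ∀ ω η : Sph N, ENNReal.ofReal (∏ i, √(Real.pi / b i) *
      Real.exp (-((ω - η : Euc N) i ^ 2 / (4 * b i)))) ≤ K ω η := by
    intro ω η
    simp only [hK]
    rw [← ENNReal.ofReal_mul (by positivity), Finset.prod_mul_distrib, hprod, ← Real.exp_sum]
    refine ENNReal.ofReal_le_ofReal ?_
    gcongr
    have h1 : ∀ i, -((ω - η : Euc N) i ^ 2 / (4 * b i)) =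
        -((if p i then R ^ 2 / 4 else τ ^ 2 / 4) * (ω - η : Euc N) i ^ 2) := by
      intro i
      simp only [hb]
      split_ifs <;> field_simp
    simp_rw [h1]
    rw [Finset.sum_neg_distrib, sum_ite_mul_sq, ← proj_sub]
    -- Decay of the kernel in the short directions is discarded; only the long directions are used.
    have : 0 ≤ τ ^ 2 / 4 * ‖proj (fun i => ¬ p i) (ω - η : Euc N)‖ ^ 2 := by positivity
    linarith
  have hM : ∀ ω, ∫⁻ η, K ω η ∂(sigma N) ≤
      ((A * (R ^ m * τ ^ k)).toNNReal * (C * (R ^ (loss k - m)).toNNReal) : ℝ≥0) := by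
    intro ω
    have hm1 : Measurable fun η : Sph N => ENNReal.ofReal
        (Real.exp (-(R ^ 2 / 4 * ‖proj p (ω : Euc N) - proj p (η : Euc N)‖ ^ 2))) := by
      have := continuous_proj p
      fun_prop
    simp only [hK]
    rw [lintegral_const_mul _ hm1]
    push_cast
    refine mul_le_mul_right ?_ _
    simp_rw [norm_sub_rev (proj p (ω : Euc N))]
    exact hC R hR _
  set M : ℝ≥0 := (A * (R ^ m * τ ^ k)).toNNReal * (C * (R ^ (loss k - m)).toNNReal) with hMdef
  have hsymm : ∀ ω η, K ω η = K η ω := fun ω η => by simp only [hK, norm_sub_rev]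
  have hschur := lintegral_mul_mul_kernel_le (f := fun ω => ‖F ω‖ₑ) hF.1.enorm hKm hsymm hM
  have hmain : ∫⁻ x, ‖rawExt F x‖ₑ ^ 2 * ENNReal.ofReal (Real.exp (-∑ i, b i * x i ^ 2)) ≤
      2 * M * ∫⁻ ω, ‖F ω‖ₑ ^ 2 ∂(sigma N) := by
    refine ((lintegral_rawExt_sq_mul_gaussian_le hb0 hF).trans ?_).trans hschur
    exact lintegral_mono fun q => mul_le_mul_right (hKle q.1 q.2) _
  have hF2 : ∫⁻ ω, ‖F ω‖ₑ ^ 2 ∂(sigma N) = eLpNorm F 2 (sigma N) ^ 2 := by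
    have := eLpNorm_nnreal_pow_eq_lintegral (f := F) (μ := sigma N) (p := 2) (by norm_num)
    simp only [NNReal.coe_ofNat, ENNReal.coe_ofNat, ENNReal.rpow_ofNat] at this
    exact this.symm
  calc ∫⁻ x in box p R τ, ‖rawExt F x‖ₑ ^ 2
      ≤ ∫⁻ x in box p R τ, ENNReal.ofReal (Real.exp 2) *
          (‖rawExt F x‖ₑ ^ 2 * ENNReal.ofReal (Real.exp (-∑ i, b i * x i ^ 2))) := by
        refine setLIntegral_mono' (measurableSet_box p R τ) fun x hx => ?_
        rw [mul_left_comm, ← ENNReal.ofReal_mul (Real.exp_pos 2).le, ← Real.exp_add]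
        refine le_mul_of_one_le_right' ?_
        rw [ENNReal.one_le_ofReal, Real.one_le_exp_iff, sum_ite_mul_sq]
        have h1 : (R ^ 2)⁻¹ * ‖proj p x‖ ^ 2 ≤ 1 := by
          rw [inv_mul_le_one₀ (by positivity)]
          exact pow_le_pow_left₀ (norm_nonneg _) hx.1 2
        have h2 : (τ ^ 2)⁻¹ * ‖proj (fun i => ¬ p i) x‖ ^ 2 ≤ 1 := by
          rw [inv_mul_le_one₀ (by positivity)]
          exact pow_le_pow_left₀ (norm_nonneg _) hx.2 2
        linarith
    _ ≤ ENNReal.ofReal (Real.exp 2) *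
          ∫⁻ x, ‖rawExt F x‖ₑ ^ 2 * ENNReal.ofReal (Real.exp (-∑ i, b i * x i ^ 2)) := by
        rw [← lintegral_const_mul' _ _ ENNReal.ofReal_ne_top]
        exact setLIntegral_le_lintegral _ _
    _ ≤ ENNReal.ofReal (Real.exp 2) * _ := mul_le_mul_right hmain _
    _ = ENNReal.ofReal (Real.exp 2 * A) * ENNReal.ofReal (R ^ m * τ ^ k * R ^ (loss k - m)) * 2 *
          C * eLpNorm F 2 (sigma N) ^ 2 := by
        rw [hF2, hMdef]
        push_cast
        change ENNReal.ofReal _ * (2 * (ENNReal.ofReal _ * (C * ENNReal.ofReal _)) * _) = _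
        rw [ENNReal.ofReal_mul (by positivity), ENNReal.ofReal_mul (p := Real.exp 2) (by positivity),
          ENNReal.ofReal_mul (p := R ^ m * τ ^ k) (by positivity)]
        ring
    _ = _ := by
        -- The volume factor `R ^ m` cancels against the sphere integral of order `R ^ (loss k -
        -- m)`.
        have : R ^ m * τ ^ k * R ^ (loss k - m) = R ^ loss k * τ ^ k := by
          rw [Real.rpow_sub hR0, Real.rpow_natCast]
          field_simp
        rw [this, hA, ← mul_assoc (Real.exp 2)]
        push_cast [ENNReal.ofReal]
        ring

end Box

/-! ### Mean values of the extension operator -/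

lemma rpow_lintegral_rpow_le {α : Type*} [MeasurableSpace α] {μ : Measure α} {f : α → ℝ≥0∞}
    (hf : AEMeasurable f μ) {q : ℝ} (hq : 0 < q) (hq2 : q ≤ 2) :
    ∫⁻ a, f a ^ q ∂μ ≤ (∫⁻ a, f a ^ 2 ∂μ) ^ (q / 2) * μ Set.univ ^ (1 - q / 2) := by
  have h := eLpNorm'_le_eLpNorm'_mul_rpow_measure_univ hq hq2 hf.aestronglyMeasurable
  simp only [eLpNorm', enorm_eq_self, ENNReal.rpow_ofNat] at h
  have h2 := ENNReal.rpow_le_rpow h hq.le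
  rw [ENNReal.mul_rpow_of_nonneg _ _ hq.le, ← ENNReal.rpow_mul, ← ENNReal.rpow_mul,
    ← ENNReal.rpow_mul, one_div_mul_cancel hq.ne', ENNReal.rpow_one] at h2
  convert h2 using 3
  · ring
  · field_simp

lemma lintegral_sq_le {α : Type*} [MeasurableSpace α] {μ : Measure α} {f : α → ℝ≥0∞}
    (hf : AEMeasurable f μ) : (∫⁻ a, f a ∂μ) ^ 2 ≤ μ Set.univ * ∫⁻ a, f a ^ 2 ∂μ := by
  have h := rpow_lintegral_rpow_le hf one_pos one_le_two
  simp only [ENNReal.rpow_one] at h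
  refine (pow_le_pow_left₀ (zero_le) h 2).trans (le_of_eq ?_)
  rw [mul_pow, ← ENNReal.rpow_mul_natCast, ← ENNReal.rpow_mul_natCast, mul_comm]
  norm_num

section MeanValue

variable {N : ℕ}

/-- The Fourier transform of the unit ball. -/
def ballTransform (ω : Euc N) : ℂ :=
  ∫ u in Metric.ball (0 : Euc N) 1, Complex.exp (Complex.I * ((inner ℝ u ω : ℝ) : ℂ))

lemma continuous_ballTransform : Continuous (ballTransform (N := N)) := by
  have : IsFiniteMeasure ((volume : Measure (Euc N)).restrict (Metric.ball 0 1)) :=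
    ⟨by simpa using measure_ball_lt_top⟩
  refine continuous_of_dominated (bound := fun _ => 1)
    (fun x => Continuous.aestronglyMeasurable (by fun_prop)) (fun x => ae_of_all _ fun ω => ?_)
    (integrable_const _) (ae_of_all _ fun ω => by fun_prop)
  rw [norm_exp_I_mul_ofReal]

/-- For `u` in the unit ball and `ω` on the sphere, `|u · ω| ≤ 1`, so the real part of the integrand
is at least `cos 1 > 0`. -/
lemma exists_le_norm_ballTransform :
    ∃ c : ℝ≥0, 0 < c ∧ ∀ ω : Sph N, c ≤ ‖ballTransform (ω : Euc N)‖ := by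
  set V := (volume : Measure (Euc N)).real (Metric.ball 0 1) with hV
  have hV0 : 0 < V :=
    ENNReal.toReal_pos (Metric.measure_ball_pos _ _ one_pos).ne' measure_ball_lt_top.ne
  have hfin : IsFiniteMeasure ((volume : Measure (Euc N)).restrict (Metric.ball 0 1)) :=
    ⟨by simpa using measure_ball_lt_top⟩
  refine ⟨(Real.cos 1 * V).toNNReal, by simpa using mul_pos Real.cos_one_pos hV0, fun ω => ?_⟩
  rw [Real.coe_toNNReal _ (mul_pos Real.cos_one_pos hV0).le]
  have hω : ‖(ω : Euc N)‖ = 1 := mem_sphere_zero_iff_norm.1 ω.2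
  have hint : Integrable (fun u : Euc N =>
      Complex.exp (Complex.I * ((inner ℝ u (ω : Euc N) : ℝ) : ℂ)))
      (volume.restrict (Metric.ball 0 1)) :=
    (integrable_const (1 : ℝ)).mono' (Continuous.aestronglyMeasurable (by fun_prop))
      (ae_of_all _ fun u => by rw [norm_exp_I_mul_ofReal])
  refine le_trans ?_ (Complex.re_le_norm _)
  rw [ballTransform, ← RCLike.re_eq_complex_re, ← integral_re hint]
  calc Real.cos 1 * V = ∫ u in Metric.ball (0 : Euc N) 1, Real.cos 1 := by
        rw [setIntegral_const, smul_eq_mul, mul_comm]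
    _ ≤ _ := by
        refine setIntegral_mono_on (integrable_const _) hint.re measurableSet_ball fun u hu => ?_
        rw [RCLike.re_eq_complex_re, mul_comm, Complex.exp_ofReal_mul_I_re,
          ← Real.cos_abs (inner ℝ u _)]
        have h1 : |inner ℝ u (ω : Euc N)| ≤ 1 := by
          refine (abs_real_inner_le_norm _ _).trans ?_
          rw [hω, mul_one]
          exact (mem_ball_zero_iff.1 hu).le
        exact Real.cos_le_cos_of_nonneg_of_le_pi (abs_nonneg _) (by linarith [Real.pi_gt_three]) h1

lemma rawExt_eq_setIntegral_ball {F : Sph N → ℂ} (hF : MemLp F 2 (sigma N)) (x : Euc N) :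
    rawExt (fun ω => ballTransform (ω : Euc N) * F ω) x =
      ∫ u in Metric.ball (0 : Euc N) 1, rawExt F (x + u) := by
  have hfin : IsFiniteMeasure ((volume : Measure (Euc N)).restrict (Metric.ball 0 1)) :=
    ⟨by simpa using measure_ball_lt_top⟩
  set H : Euc N × Sph N → ℂ := fun z =>
    Complex.exp (Complex.I * ((inner ℝ (x + z.1) (z.2 : Euc N) : ℝ) : ℂ)) * F z.2 with hH
  have hint : Integrable H ((volume.restrict (Metric.ball 0 1)).prod (sigma N)) := by
    refine ((hF.integrable (by norm_num)).comp_snd _).bdd_mul (c := 1) (by fun_prop)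
      (ae_of_all _ fun z => ?_)
    rw [norm_exp_I_mul_ofReal]
  change _ = ∫ u in Metric.ball (0 : Euc N) 1, ∫ ω, H (u, ω) ∂(sigma N)
  rw [integral_integral_swap hint]
  unfold rawExt ballTransform
  congr with ω
  rw [mul_left_comm, ← integral_mul_const]
  congr with u
  simp only [hH, inner_add_left, Complex.ofReal_add, mul_add, Complex.exp_add]
  ring

/-- A substitute for the mean value property. Averaging an extension over unit balls multiplies its
density by `ballTransform`, which is bounded away from zero on the sphere. Dividing `F` by it
therefore writes the extension of `F` as such an average, and Cauchy–Schwarz gives the square. -/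
lemma exists_enorm_rawExt_sq_le_lintegral_ball :
    ∃ C : ℝ≥0, ∀ F : Sph N → ℂ, MemLp F 2 (sigma N) → ∃ F' : Sph N → ℂ, MemLp F' 2 (sigma N) ∧
      eLpNorm F' 2 (sigma N) ≤ C * eLpNorm F 2 (sigma N) ∧
      ∀ x, ‖rawExt F x‖ₑ ^ 2 ≤ C * ∫⁻ u in Metric.ball x 1, ‖rawExt F' u‖ₑ ^ 2 := by
  obtain ⟨c, hc0, hc⟩ := exists_le_norm_ballTransform (N := N)
  set V := (volume : Measure (Euc N)) (Metric.ball 0 1) with hV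
  have hVt : V ≠ ∞ := measure_ball_lt_top.ne
  have hc0' : (0 : ℝ) < c := hc0
  have hb : ∀ ω : Sph N, ballTransform (ω : Euc N) ≠ 0 := fun ω =>
    norm_pos_iff.1 (hc0'.trans_le (hc ω))
  refine ⟨max c⁻¹ V.toNNReal, fun F hF => ?_⟩
  set F' := fun ω : Sph N => (ballTransform (ω : Euc N))⁻¹ * F ω with hF'def
  have hmeas : AEStronglyMeasurable F' (sigma N) :=
    (((continuous_ballTransform.comp continuous_subtype_val).inv₀ hb).aestronglyMeasurable).mul hF.1
  have hbd : ∀ ω : Sph N, ‖F' ω‖ ≤ (c⁻¹ : ℝ≥0) * ‖F ω‖ := fun ω => by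
    rw [norm_mul, norm_inv, NNReal.coe_inv]
    gcongr
    exact hc ω
  have hF' : MemLp F' 2 (sigma N) := hF.of_le_mul hmeas (ae_of_all _ hbd)
  refine ⟨F', hF', ?_, fun x => ?_⟩
  · refine (eLpNorm_le_nnreal_smul_eLpNorm_of_ae_le_mul (ae_of_all _ hbd) 2).trans ?_
    rw [ENNReal.smul_def, smul_eq_mul]
    gcongr
    exact le_max_left _ _
  · have h1 : F = fun ω : Sph N => ballTransform (ω : Euc N) * F' ω := by
      funext ω
      simp only [hF'def]
      rw [mul_inv_cancel_left₀ (hb ω)]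
    have h2 : ‖rawExt F x‖ₑ ≤ ∫⁻ u in Metric.ball x 1, ‖rawExt F' u‖ₑ := by
      conv_lhs => rw [h1, rawExt_eq_setIntegral_ball hF']
      refine (enorm_integral_le_lintegral_enorm _).trans (le_of_eq ?_)
      rw [← lintegral_indicator measurableSet_ball, ← lintegral_indicator measurableSet_ball,
        ← lintegral_add_left_eq_self ((Metric.ball x 1).indicator _) x]
      refine lintegral_congr fun u => ?_
      classical
      simp only [Set.indicator_apply, mem_ball_iff_norm, sub_zero, add_sub_cancel_left]
    refine (pow_le_pow_left₀ (zero_le) h2 2).trans ((lintegral_sq_le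
      (continuous_rawExt hF').enorm.measurable.aemeasurable).trans ?_)
    rw [Measure.restrict_apply_univ, Measure.addHaar_ball_center, ← hV, ← ENNReal.coe_toNNReal hVt]
    gcongr
    exact le_max_right _ _

end MeanValue

/-! ### Invariance under orthogonal matrices -/

section Invariance

open scoped Pointwise

variable {N : ℕ}

/-- The linear isometry of `ℝ^N` given by an orthogonal matrix. -/
def toIsometry (A : Matrix.orthogonalGroup (Fin N) ℝ) : Euc N ≃ₗᵢ[ℝ] Euc N :=
  LinearIsometry.toLinearIsometryEquiv
    ⟨Matrix.toEuclideanLin (A : Matrix (Fin N) (Fin N) ℝ), fun x => by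
      have hA : (A : Matrix (Fin N) (Fin N) ℝ).transpose * (A : Matrix (Fin N) (Fin N) ℝ) = 1 :=
        (Matrix.mem_orthogonalGroup_iff' _ _).1 A.2
      have key : dotProduct ((A : Matrix (Fin N) (Fin N) ℝ).mulVec x.ofLp)
          ((A : Matrix (Fin N) (Fin N) ℝ).mulVec x.ofLp) = dotProduct x.ofLp x.ofLp := by
        rw [Matrix.dotProduct_mulVec, Matrix.vecMul_mulVec, hA, Matrix.vecMul_one]
      rw [EuclideanSpace.norm_eq, EuclideanSpace.norm_eq]
      simp only [Real.norm_eq_abs, sq_abs]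
      change √(∑ i, (A : Matrix (Fin N) (Fin N) ℝ).mulVec x.ofLp i ^ 2) = _
      simpa only [dotProduct, pow_two] using congrArg Real.sqrt key⟩ rfl

lemma toIsometry_apply (A : Matrix.orthogonalGroup (Fin N) ℝ) (x : Euc N) :
    toIsometry A x = WithLp.toLp 2 ((A : Matrix (Fin N) (Fin N) ℝ).mulVec x.ofLp) := rfl

lemma coe_act (A : Matrix.orthogonalGroup (Fin N) ℝ) (ω : Sph N) :
    (act A ω : Euc N) = toIsometry A ω := rfl

lemma measurePreserving_act (A : Matrix.orthogonalGroup (Fin N) ℝ) :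
    MeasurePreserving (act A) (sigma N) (sigma N) := by
  have hcont : Continuous (act A) :=
    Continuous.subtype_mk ((toIsometry A).continuous.comp continuous_subtype_val) _
  refine ⟨hcont.measurable, ?_⟩
  ext s hs
  rw [Measure.map_apply hcont.measurable hs]
  unfold sigma
  rw [Measure.toSphere_apply' _ hs, Measure.toSphere_apply' _ (hcont.measurable hs),
    ← (toIsometry A).measurePreserving.measure_preimage_emb
      (toIsometry A).toHomeomorph.measurableEmbedding (Set.Ioo (0 : ℝ) 1 • (Subtype.val '' s))]
  congr 2
  ext x
  simp only [Set.mem_smul, Set.mem_image, Set.mem_preimage]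
  constructor
  · rintro ⟨r, hr, _, ⟨η, hη, rfl⟩, rfl⟩
    exact ⟨r, hr, _, ⟨_, hη, rfl⟩, by rw [map_smul, coe_act]⟩
  · rintro ⟨r, hr, _, ⟨ω, hω, rfl⟩, hx⟩
    have hnorm : ‖x‖ = r := by
      rw [← (toIsometry A).norm_map, ← hx, norm_smul, mem_sphere_zero_iff_norm.1 ω.2,
        Real.norm_of_nonneg hr.1.le, mul_one]
    have hη : r⁻¹ • x ∈ Metric.sphere (0 : Euc N) 1 := by
      rw [mem_sphere_zero_iff_norm, norm_smul, hnorm, Real.norm_of_nonneg (inv_pos.2 hr.1).le,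
        inv_mul_cancel₀ hr.1.ne']
    refine ⟨r, hr, _, ⟨⟨_, hη⟩, ?_, rfl⟩, smul_inv_smul₀ hr.1.ne' x⟩
    convert hω
    refine Subtype.ext ?_
    rw [coe_act, map_smul, ← hx, inv_smul_smul₀ hr.1.ne']

lemma rawExt_toIsometry {F : Sph N → ℂ} (hF : MemLp F 2 (sigma N))
    {A : Matrix.orthogonalGroup (Fin N) ℝ} (hA : ∀ ω, F (act A ω) = F ω) (x : Euc N) :
    rawExt F (toIsometry A x) = rawExt F x := by
  unfold rawExt
  have h := measurePreserving_act A
  nth_rw 1 [← h.map_eq]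
  rw [integral_map h.measurable.aemeasurable
    (by rw [h.map_eq]; exact (integrable_exp_mul hF _).1)]
  simp_rw [hA, coe_act, LinearIsometryEquiv.inner_map_map]

/-- The orthogonal matrix of the reflection in the hyperplane orthogonal to `v`. -/
def reflectionMatrix (v : Fin N → ℝ) : Matrix.orthogonalGroup (Fin N) ℝ :=
  ⟨1 - (2 / dotProduct v v) • Matrix.vecMulVec v v, by
    rw [Matrix.mem_orthogonalGroup_iff]
    rw [Matrix.transpose_sub, Matrix.transpose_one, Matrix.transpose_smul,
      Matrix.transpose_vecMulVec, mul_sub, sub_mul, sub_mul, mul_one, one_mul, mul_one,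
      smul_mul_smul_comm, Matrix.vecMulVec_mul_vecMulVec]
    -- If `v = 0`, division by zero makes the coefficient zero and the matrix is the identity.
    by_cases hv : dotProduct v v = 0
    · simp [hv]
    · rw [Matrix.vecMulVec_smul, smul_smul]
      have : 2 / dotProduct v v * (2 / dotProduct v v) * dotProduct v v =
          2 * (2 / dotProduct v v) := by
        field_simp
      rw [this]
      module⟩

/-- The extension of a function invariant under block diagonal orthogonal matrices depends only on
the norm of the projection onto each of the blocks. -/
lemma rawExt_eq_of_norm_proj_eq {F : Sph N → ℂ} (hF : MemLp F 2 (sigma N))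
    (p : Fin N → Prop) [DecidablePred p] {G : Subgroup (Matrix.orthogonalGroup (Fin N) ℝ)}
    (hG : ∀ A : Matrix.orthogonalGroup (Fin N) ℝ, (∀ i j : Fin N, ¬(p i ↔ p j) →
      (A : Matrix (Fin N) (Fin N) ℝ) i j = 0) → A ∈ G)
    (hinv : IsInvariant G F) {x y : Euc N} (hxy : ‖proj p x‖ = ‖proj p y‖)
    (hxy' : proj (fun i => ¬ p i) x = proj (fun i => ¬ p i) y) :
    rawExt F x = rawExt F y := by
  -- The reflection that exchanges `x` and `y` is along `x - y`. This vector is supported on the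
  -- block `p`, so the reflection is block diagonal.
  set v : Fin N → ℝ := fun i => x i - y i with hv
  have hv0 : ∀ i, ¬ p i → v i = 0 := fun i hi => by
    have := congrArg (fun z : EuclideanSpace ℝ {i // ¬ p i} => z ⟨i, hi⟩) hxy'
    simpa [proj, hv, sub_eq_zero] using this
  have hmem : reflectionMatrix v ∈ G := by
    refine hG _ fun i j hij => ?_
    have hne : i ≠ j := by rintro rfl; exact hij Iff.rfl
    have hvv : v i * v j = 0 := by
      by_cases hi : p i
      · rw [hv0 j (by tauto), mul_zero]
      · rw [hv0 i hi, zero_mul]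
    simp [reflectionMatrix, Matrix.one_apply_ne hne, Matrix.vecMulVec_apply, hvv]
  have hnorm : dotProduct v v = 2 * dotProduct v x.ofLp := by
    have h1 : ‖x‖ ^ 2 = ‖y‖ ^ 2 := by
      rw [← norm_proj_sq_add p x, ← norm_proj_sq_add p y, hxy, hxy']
    rw [EuclideanSpace.norm_sq_eq, EuclideanSpace.norm_sq_eq] at h1
    simp only [Real.norm_eq_abs, sq_abs] at h1
    have h2 : dotProduct v v - 2 * dotProduct v x.ofLp = ∑ i, y i ^ 2 - ∑ i, x i ^ 2 := by
      simp only [dotProduct, Finset.mul_sum, ← Finset.sum_sub_distrib, hv]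
      refine Finset.sum_congr rfl fun i _ => ?_
      ring
    linarith
  have hmap : toIsometry (reflectionMatrix v) x = y := by
    rw [toIsometry_apply]
    ext i
    simp only [reflectionMatrix, Matrix.sub_mulVec, Matrix.one_mulVec, Matrix.smul_mulVec,
      Matrix.vecMulVec_mulVec, Pi.sub_apply, Pi.smul_apply, smul_eq_mul]
    by_cases h0 : dotProduct v v = 0
    · have : v i = 0 := congrFun (dotProduct_self_eq_zero.1 h0) i
      simp only [this]
      simp only [hv] at this
      simp
      linarith
    · have : 2 / dotProduct v v * (dotProduct v x.ofLp) = 1 := by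
        rw [div_mul_eq_mul_div, ← hnorm, div_self h0]
      rw [op_smul_eq_mul, mul_comm (v i), ← mul_assoc, this, one_mul]
      simp [hv]
  rw [← hmap, rawExt_toIsometry hF (hinv _ hmem)]

end Invariance

/-! ### Pointwise decay -/

section Decay

variable {N : ℕ} (p : Fin N → Prop) [DecidablePred p]

/-- The points whose projections are close to the projections of `x` up to a rotation of the
coordinates satisfying `p`. -/
def shell (x : Euc N) : Set (Euc N) :=
  {y | ‖proj p x‖ ≤ ‖proj p y‖ ∧ ‖proj p y‖ < ‖proj p x‖ + 1 ∧
    ‖proj (fun i => ¬ p i) y - proj (fun i => ¬ p i) x‖ < 1}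

lemma shell_eq_preimage (x : Euc N) : shell p x =
    (fun y : Euc N => (proj p y, proj (fun i => ¬ p i) y)) ⁻¹'
      ((Metric.ball 0 (‖proj p x‖ + 1) \ Metric.ball 0 ‖proj p x‖) ×ˢ
        Metric.ball (proj (fun i => ¬ p i) x) 1) := by
  ext y
  simp only [shell, Set.mem_ofPred_eq, Set.mem_preimage, Set.mem_prod, Set.mem_sdiff,
    mem_ball_iff_norm, sub_zero, not_lt]
  tauto

lemma measurableSet_shell (x : Euc N) : MeasurableSet (shell p x) := by
  rw [shell_eq_preimage]
  exact ((measurableSet_ball.diff measurableSet_ball).prod measurableSet_ball).preimage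
    (measurePreserving_proj_prod p).measurable

lemma exists_le_volume_shell (hp : 1 ≤ Fintype.card {i // p i}) :
    ∃ c : ℝ≥0, 0 < c ∧ ∀ x : Euc N,
      c * ENNReal.ofReal (‖proj p x‖ ^ (Fintype.card {i // p i} - 1)) ≤ volume (shell p x) := by
  set V := volume (Metric.ball (0 : EuclideanSpace ℝ {i // p i}) 1) with hV
  set W := volume (Metric.ball (0 : EuclideanSpace ℝ {i // ¬ p i}) 1) with hW
  have hVt : V ≠ ∞ := measure_ball_lt_top.ne
  have hWt : W ≠ ∞ := measure_ball_lt_top.ne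
  have hV0 : V ≠ 0 := (Metric.measure_ball_pos _ _ one_pos).ne'
  have hW0 : W ≠ 0 := (Metric.measure_ball_pos _ _ one_pos).ne'
  have : Nonempty {i // p i} := Fintype.card_pos_iff.1 hp
  set m := Fintype.card {i // p i} with hm
  refine ⟨V.toNNReal * W.toNNReal, mul_pos (ENNReal.toNNReal_pos hV0 hVt)
    (ENNReal.toNNReal_pos hW0 hWt), fun x => ?_⟩
  set a := ‖proj p x‖ with ha
  have ha0 : 0 ≤ a := norm_nonneg _
  rw [shell_eq_preimage, (measurePreserving_proj_prod p).measure_preimage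
    ((measurableSet_ball.diff measurableSet_ball).prod measurableSet_ball).nullMeasurableSet,
    Measure.prod_prod, measure_sdiff (Metric.ball_subset_ball (by linarith))
    measurableSet_ball.nullMeasurableSet measure_ball_lt_top.ne,
    Measure.addHaar_ball_center volume (proj (fun i => ¬ p i) x),
    Measure.addHaar_ball _ _ (by positivity), Measure.addHaar_ball _ _ ha0, ← hV, ← hW, ← ha,
    ← ENNReal.sub_mul (fun _ _ => hVt), ← ENNReal.ofReal_sub _ (by positivity),
    finrank_euclideanSpace, ← hm]
  push_cast
  rw [ENNReal.coe_toNNReal hVt, ENNReal.coe_toNNReal hWt, mul_comm, ← mul_assoc]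
  gcongr
  obtain ⟨n, hn⟩ : ∃ n, m = n + 1 := ⟨m - 1, by omega⟩
  rw [hn, Nat.add_sub_cancel, pow_succ, pow_succ]
  -- This yields `(a + 1) ^ (n + 1) - a ^ (n + 1) ≥ a ^ n`.
  have : a ^ n ≤ (a + 1) ^ n := pow_le_pow_left₀ ha0 (by linarith) n
  nlinarith

variable {p}

/-- A point with the same projections as `x`, up to a rotation, close to a given point of
`shell p x`. -/
lemma exists_dist_lt_two_of_mem_shell {x y : Euc N} (hx : 0 < ‖proj p x‖) (hy : y ∈ shell p x) :
    ∃ z : Euc N, ‖proj p x‖ = ‖proj p z‖ ∧ proj (fun i => ¬ p i) x = proj (fun i => ¬ p i) z ∧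
      dist z y < 2 := by
  obtain ⟨h1, h2, h3⟩ := hy
  have hy0 : 0 < ‖proj p y‖ := hx.trans_le h1
  set t := ‖proj p x‖ / ‖proj p y‖ with ht
  -- The block `p` of `y` is rescaled to the norm of that of `x`, and the other block is taken from
  -- `x`. Each block moves by at most 1, so the distance is at most `√2`.
  set z : Euc N := WithLp.toLp 2 fun i => if p i then t * y i else x i with hz
  have hzp : proj p z = t • proj p y := by
    ext i
    simp [proj, hz, i.2]
  have hzn : proj (fun i => ¬ p i) z = proj (fun i => ¬ p i) x := by
    ext i
    simp [proj, hz, i.2]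
  refine ⟨z, ?_, hzn.symm, ?_⟩
  · rw [hzp, norm_smul, ht, Real.norm_of_nonneg (by positivity), div_mul_cancel₀ _ hy0.ne']
  · have h4 : ‖proj p (z - y)‖ ≤ 1 := by
      have : proj p (z - y) = (t - 1) • proj p y := by rw [proj_sub, hzp]; module
      have ht1 : t ≤ 1 := (div_le_one hy0).2 h1
      have ht2 : t * ‖proj p y‖ = ‖proj p x‖ := div_mul_cancel₀ _ hy0.ne'
      rw [this, norm_smul, Real.norm_eq_abs, abs_of_nonpos (by linarith)]
      linarith
    have h5 : ‖proj (fun i => ¬ p i) (z - y)‖ < 1 := by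
      rw [proj_sub, hzn, norm_sub_rev]
      exact h3
    rw [dist_eq_norm]
    have h6 := norm_proj_sq_add p (z - y)
    refine lt_of_pow_lt_pow_left₀ 2 (by norm_num) ?_
    nlinarith [norm_nonneg (proj p (z - y)), norm_nonneg (proj (fun i => ¬ p i) (z - y))]

/-- By Tonelli, each `u` is counted for a set of `y` of volume at most that of a ball of radius 3,
and every `u` that occurs lies in the enlarged box. -/
lemma lintegral_shell_lintegral_ball_le {f : Euc N → ℝ≥0∞} (hf : Measurable f) {x : Euc N} {b : ℝ}
    (hb : ‖proj (fun i => ¬ p i) x‖ ≤ b) :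
    ∫⁻ y in shell p x, ∫⁻ u in Metric.ball y 3, f u ≤
      volume (Metric.ball (0 : Euc N) 3) * ∫⁻ u in box p (‖proj p x‖ + 4) (b + 4), f u := by
  set B := box p (‖proj p x‖ + 4) (b + 4) with hB
  have hBm : MeasurableSet B := measurableSet_box _ _ _
  set T : Set (Euc N × Euc N) := {w | dist w.2 w.1 < 3} with hT
  have hTm : MeasurableSet T := measurableSet_lt (by fun_prop) measurable_const
  set G : Euc N × Euc N → ℝ≥0∞ := T.indicator fun w => B.indicator f w.2 with hG
  have hGm : Measurable G := ((hf.indicator hBm).comp measurable_snd).indicator hTm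
  calc ∫⁻ y in shell p x, ∫⁻ u in Metric.ball y 3, f u
      ≤ ∫⁻ y in shell p x, ∫⁻ u, G (y, u) := by
        refine setLIntegral_mono' (measurableSet_shell p x) fun y hy => ?_
        rw [← lintegral_indicator measurableSet_ball]
        refine lintegral_mono fun u => ?_
        by_cases hu : u ∈ Metric.ball y 3
        · have huB : u ∈ B := by
            have hd : ‖u - y‖ < 3 := by rwa [← dist_eq_norm]
            have e1 := norm_proj_le p (u - y)
            have e2 := norm_proj_le (fun i => ¬ p i) (u - y)
            rw [proj_sub] at e1 e2
            have e3 := norm_le_norm_sub_add (proj p u) (proj p y)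
            have e4 := norm_le_norm_sub_add (proj (fun i => ¬ p i) u) (proj (fun i => ¬ p i) y)
            have e5 := norm_le_norm_sub_add (proj (fun i => ¬ p i) y) (proj (fun i => ¬ p i) x)
            have e6 := hy.2.1
            have e7 := hy.2.2
            exact ⟨by linarith, by linarith⟩
          have huT : (y, u) ∈ T := hu
          simp only [hG]
          rw [Set.indicator_of_mem hu, Set.indicator_of_mem huT]
          simp only
          rw [Set.indicator_of_mem huB]
        · rw [Set.indicator_of_notMem hu]
          exact zero_le
    _ ≤ ∫⁻ y, ∫⁻ u, G (y, u) := setLIntegral_le_lintegral _ _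
    _ = ∫⁻ u, ∫⁻ y, G (y, u) := lintegral_lintegral_swap hGm.aemeasurable
    _ = ∫⁻ u, volume (Metric.ball (0 : Euc N) 3) * B.indicator f u := by
        refine lintegral_congr fun u => ?_
        have : ∀ y, G (y, u) = (Metric.ball u 3).indicator (fun _ => B.indicator f u) y := by
          intro y
          classical
          simp only [hG, hT, Set.indicator_apply, Set.mem_ofPred_eq, Metric.mem_ball, dist_comm]
        simp_rw [this]
        rw [lintegral_indicator_const measurableSet_ball, Measure.addHaar_ball_center, mul_comm]
    _ = _ := by
        rw [lintegral_const_mul _ (hf.indicator hBm), lintegral_indicator hBm]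

variable (p)

/-- Every `y` in the shell is within 2 of a point with the same extension value as `x`, so `‖rawExt
F x‖ₑ ^ 2` is bounded by a local integral around `y`. Integrating over the shell gains its volume,
while the box estimate bounds the right-hand side by a power `loss` of the radius. -/
lemma exists_enorm_rawExt_sq_le_rpow (hp : 1 ≤ Fintype.card {i // p i})
    (hp' : 1 ≤ Fintype.card {i // ¬ p i}) {G : Subgroup (Matrix.orthogonalGroup (Fin N) ℝ)}
    (hG : ∀ A : Matrix.orthogonalGroup (Fin N) ℝ, (∀ i j : Fin N, ¬(p i ↔ p j) →
      (A : Matrix (Fin N) (Fin N) ℝ) i j = 0) → A ∈ G) (b : ℝ) :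
    ∃ C : ℝ≥0, ∀ F : Sph N → ℂ, MemLp F 2 (sigma N) → IsInvariant G F → ∀ x : Euc N,
      1 ≤ ‖proj p x‖ → ‖proj (fun i => ¬ p i) x‖ ≤ b → ‖rawExt F x‖ₑ ^ 2 ≤
        C * ENNReal.ofReal (‖proj p x‖ ^ (loss (Fintype.card {i // ¬ p i}) -
          (Fintype.card {i // p i} - 1))) * eLpNorm F 2 (sigma N) ^ 2 := by
  obtain ⟨C₁, hC₁⟩ := exists_enorm_rawExt_sq_le_lintegral_ball (N := N)
  obtain ⟨C₂, hC₂⟩ := exists_lintegral_box_rawExt_sq_le p hp'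
  obtain ⟨c, hc0, hc⟩ := exists_le_volume_shell p hp
  set V := volume (Metric.ball (0 : Euc N) 3) with hV
  have hVt : V ≠ ∞ := measure_ball_lt_top.ne
  set k := Fintype.card {i // ¬ p i} with hk
  set m := Fintype.card {i // p i} with hm
  have hloss : 0 ≤ loss k := by unfold loss; split_ifs <;> norm_num
  set D : ℝ≥0 := C₁ * V.toNNReal * C₂ * (5 ^ loss k * (|b| + 4) ^ k : ℝ).toNNReal * C₁ ^ 2 with hD
  refine ⟨c⁻¹ * D, fun F hF hinv x hx hxb => ?_⟩
  obtain ⟨F', hF', hFF', hmean⟩ := hC₁ F hF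
  set a := ‖proj p x‖ with ha
  have ha0 : 0 < a := by linarith
  have hmeas := (continuous_rawExt hF').enorm.measurable.pow_const 2
  have hpt : ∀ y ∈ shell p x,
      ‖rawExt F x‖ₑ ^ 2 ≤ C₁ * ∫⁻ u in Metric.ball y 3, ‖rawExt F' u‖ₑ ^ 2 := by
    intro y hy
    obtain ⟨z, hz1, hz2, hz3⟩ := exists_dist_lt_two_of_mem_shell ha0 hy
    rw [rawExt_eq_of_norm_proj_eq hF p hG hinv hz1 hz2]
    refine (hmean z).trans (mul_le_mul_right (lintegral_mono_set ?_) _)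
    exact Metric.ball_subset_ball' (by linarith)
  have hmain : volume (shell p x) * ‖rawExt F x‖ₑ ^ 2 ≤
      D * ENNReal.ofReal (a ^ loss k) * eLpNorm F 2 (sigma N) ^ 2 := by
    calc volume (shell p x) * ‖rawExt F x‖ₑ ^ 2
        = ∫⁻ y in shell p x, ‖rawExt F x‖ₑ ^ 2 := by rw [setLIntegral_const, mul_comm]
      _ ≤ ∫⁻ y in shell p x, C₁ * ∫⁻ u in Metric.ball y 3, ‖rawExt F' u‖ₑ ^ 2 :=
          setLIntegral_mono' (measurableSet_shell p x) hpt
      _ = C₁ * ∫⁻ y in shell p x, ∫⁻ u in Metric.ball y 3, ‖rawExt F' u‖ₑ ^ 2 :=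
          lintegral_const_mul' _ _ ENNReal.coe_ne_top
      _ ≤ C₁ * (V * ∫⁻ u in box p (a + 4) (|b| + 4), ‖rawExt F' u‖ₑ ^ 2) := by
          gcongr
          exact lintegral_shell_lintegral_ball_le hmeas (hxb.trans (le_abs_self b))
      _ ≤ C₁ * (V * (C₂ * ENNReal.ofReal ((a + 4) ^ loss k * (|b| + 4) ^ k) *
            eLpNorm F' 2 (sigma N) ^ 2)) := by
          gcongr
          exact hC₂ F' hF' _ _ (by linarith) (by positivity)
      _ ≤ C₁ * (V * (C₂ * ENNReal.ofReal ((5 * a) ^ loss k * (|b| + 4) ^ k) *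
            (C₁ * eLpNorm F 2 (sigma N)) ^ 2)) := by
          gcongr
          linarith
      _ = _ := by
          have : (5 * a) ^ loss k * (|b| + 4) ^ k = (5 ^ loss k * (|b| + 4) ^ k) * a ^ loss k := by
            rw [Real.mul_rpow (by norm_num) ha0.le]; ring
          rw [this, ENNReal.ofReal_mul (by positivity), hD]
          push_cast
          rw [ENNReal.coe_toNNReal hVt]
          change _ = _ * ENNReal.ofReal _ * _ * _ * _
          ring
  have hE : (c : ℝ≥0∞) * ENNReal.ofReal (a ^ (m - 1)) * ‖rawExt F x‖ₑ ^ 2 ≤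
      D * ENNReal.ofReal (a ^ loss k) * eLpNorm F 2 (sigma N) ^ 2 :=
    (mul_le_mul_left (hc x) _).trans hmain
  calc ‖rawExt F x‖ₑ ^ 2
      = (c⁻¹ : ℝ≥0) * ENNReal.ofReal ((a ^ (m - 1))⁻¹) *
          (c * ENNReal.ofReal (a ^ (m - 1)) * ‖rawExt F x‖ₑ ^ 2) := by
        have e1 : ((c⁻¹ : ℝ≥0) : ℝ≥0∞) * c = 1 := by
          rw [← ENNReal.coe_mul, inv_mul_cancel₀ hc0.ne', ENNReal.coe_one]
        have e2 : ENNReal.ofReal ((a ^ (m - 1))⁻¹) * ENNReal.ofReal (a ^ (m - 1)) = 1 := by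
          rw [← ENNReal.ofReal_mul (by positivity), inv_mul_cancel₀ (by positivity),
            ENNReal.ofReal_one]
        calc _ = (((c⁻¹ : ℝ≥0) : ℝ≥0∞) * c) *
            (ENNReal.ofReal ((a ^ (m - 1))⁻¹) * ENNReal.ofReal (a ^ (m - 1))) *
              ‖rawExt F x‖ₑ ^ 2 := by rw [e1, e2, one_mul, one_mul]
          _ = _ := by ring
    _ ≤ (c⁻¹ : ℝ≥0) * ENNReal.ofReal ((a ^ (m - 1))⁻¹) *
          (D * ENNReal.ofReal (a ^ loss k) * eLpNorm F 2 (sigma N) ^ 2) := mul_le_mul_right hE _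
    _ = _ := by
        have : a ^ (loss k - (m - 1)) = (a ^ (m - 1))⁻¹ * a ^ loss k := by
          rw [Real.rpow_sub ha0, ← Nat.cast_one (R := ℝ), ← Nat.cast_sub hp, Real.rpow_natCast]
          field_simp
        rw [this, ENNReal.ofReal_mul (by positivity)]
        push_cast
        ring

end Decay

/-! ### Estimates on arms -/

section Arm

variable {N : ℕ}

/-- The unnormalised extension operator is bounded from the `G`-invariant functions in `L²` to
`L^q(A)`. -/
def ExtensionEstimate (G : Subgroup (Matrix.orthogonalGroup (Fin N) ℝ)) (A : Set (Euc N))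
    (q : ℝ) : Prop :=
  ∃ C : ℝ≥0, ∀ F : Sph N → ℂ, MemLp F 2 (sigma N) → IsInvariant G F →
    ∫⁻ x in A, ‖rawExt F x‖ₑ ^ q ≤ C * eLpNorm F 2 (sigma N) ^ q

variable {G : Subgroup (Matrix.orthogonalGroup (Fin N) ℝ)} {A B : Set (Euc N)} {q : ℝ}

lemma ExtensionEstimate.mono (h : ExtensionEstimate G B q) (hAB : A ⊆ B) :
    ExtensionEstimate G A q := by
  obtain ⟨C, hC⟩ := h
  exact ⟨C, fun F hF hG => (lintegral_mono_set hAB).trans (hC F hF hG)⟩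

lemma ExtensionEstimate.union (hA : ExtensionEstimate G A q) (hB : ExtensionEstimate G B q) :
    ExtensionEstimate G (A ∪ B) q := by
  obtain ⟨C, hC⟩ := hA
  obtain ⟨D, hD⟩ := hB
  refine ⟨C + D, fun F hF hG => (lintegral_union_le _ _ _).trans ?_⟩
  push_cast
  rw [add_mul]
  exact add_le_add (hC F hF hG) (hD F hF hG)

lemma exists_setLIntegral_rawExt_rpow_le (hq : 0 ≤ q) : ∃ C : ℝ≥0, ∀ F : Sph N → ℂ,
    MemLp F 2 (sigma N) → ∀ A : Set (Euc N),
      ∫⁻ x in A, ‖rawExt F x‖ₑ ^ q ≤ C * volume A * eLpNorm F 2 (sigma N) ^ q := by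
  obtain ⟨C, hC⟩ := exists_enorm_rawExt_le N
  refine ⟨C ^ q, fun F hF A => ?_⟩
  calc ∫⁻ x in A, ‖rawExt F x‖ₑ ^ q
      ≤ ∫⁻ x in A, (C * eLpNorm F 2 (sigma N)) ^ q :=
        lintegral_mono fun x => ENNReal.rpow_le_rpow (hC F hF x) hq
    _ = _ := by
        rw [setLIntegral_const, ENNReal.mul_rpow_of_nonneg _ _ hq, ENNReal.coe_rpow_of_nonneg _ hq]
        ring

lemma extensionEstimate_of_volume_ne_top (hA : volume A ≠ ∞) (hq : 0 ≤ q) :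
    ExtensionEstimate G A q := by
  obtain ⟨C, hC⟩ := exists_setLIntegral_rawExt_rpow_le (N := N) hq
  refine ⟨C * (volume A).toNNReal, fun F hF _ => ?_⟩
  push_cast
  rw [ENNReal.coe_toNNReal hA]
  exact hC F hF A

/-- The excess power `q - q₀` is absorbed by the uniform bound on the extension. The constant does
not depend on `q`. -/
lemma ExtensionEstimate.exists_eLpNorm_indicator_le {q₀ : ℝ} (h : ExtensionEstimate G A q₀)
    (hq₀ : 1 ≤ q₀) : ∃ C : ℝ≥0, ∀ q : ℝ, q₀ ≤ q → ∀ F : Sph N → ℂ, MemLp F 2 (sigma N) →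
      IsInvariant G F → eLpNorm (A.indicator (extension F)) (ENNReal.ofReal q) volume ≤
        C * eLpNorm F 2 (sigma N) := by
  obtain ⟨C₀, hC₀⟩ := h
  obtain ⟨C₁, hC₁⟩ := exists_enorm_rawExt_le N
  -- Since `D ≥ 1` and `q₀ ≥ 1`, also `C₀ ≤ D ^ q₀`, so both bounds are expressed through powers of
  -- `D * M`.
  set D : ℝ≥0 := max 1 (max C₀ C₁) with hD
  have hD0 : C₀ ≤ D := (le_max_left _ _).trans (le_max_right _ _)
  have hD1 : C₁ ≤ D := (le_max_right _ _).trans (le_max_right _ _)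
  have hD2 : 1 ≤ D := le_max_left _ _
  refine ⟨D, fun q hq F hF hinv => ?_⟩
  have hq0 : 0 < q := by linarith
  set M := eLpNorm F 2 (sigma N) with hM
  have key : ∫⁻ x, ‖A.indicator (extension F) x‖ₑ ^ q ≤ (D * M) ^ q := by
    calc ∫⁻ x, ‖A.indicator (extension F) x‖ₑ ^ q
        ≤ ∫⁻ x, A.indicator (fun x => ‖rawExt F x‖ₑ ^ q) x := by
          refine lintegral_mono fun x => ?_
          by_cases hx : x ∈ A
          · rw [Set.indicator_of_mem hx, Set.indicator_of_mem hx]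
            exact ENNReal.rpow_le_rpow (enorm_extension_le F x) hq0.le
          · rw [Set.indicator_of_notMem hx, enorm_zero, ENNReal.zero_rpow_of_pos hq0]
            exact zero_le
      _ ≤ ∫⁻ x in A, ‖rawExt F x‖ₑ ^ q := lintegral_indicator_le _ _
      _ ≤ ∫⁻ x in A, (D * M) ^ (q - q₀) * ‖rawExt F x‖ₑ ^ q₀ := by
          refine lintegral_mono fun x => ?_
          calc ‖rawExt F x‖ₑ ^ q = ‖rawExt F x‖ₑ ^ (q - q₀) * ‖rawExt F x‖ₑ ^ q₀ := by
                rw [← ENNReal.rpow_add_of_nonneg _ _ (by linarith) (by linarith), sub_add_cancel]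
            _ ≤ _ := by
                gcongr
                exact (hC₁ F hF x).trans (by gcongr)
      _ = (D * M) ^ (q - q₀) * ∫⁻ x in A, ‖rawExt F x‖ₑ ^ q₀ :=
          lintegral_const_mul' _ _ (by
            have : M ≠ ∞ := hF.2.ne
            finiteness)
      _ ≤ (D * M) ^ (q - q₀) * (D * M) ^ q₀ := by
          gcongr
          refine (hC₀ F hF hinv).trans ?_
          rw [ENNReal.mul_rpow_of_nonneg _ _ (by linarith)]
          gcongr
          calc (C₀ : ℝ≥0∞) ≤ D := by exact_mod_cast hD0
            _ = (D : ℝ≥0∞) ^ (1 : ℝ) := (ENNReal.rpow_one _).symm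
            _ ≤ _ := ENNReal.rpow_le_rpow_of_exponent_le (by exact_mod_cast hD2) hq₀
      _ = _ := by
          rw [← ENNReal.rpow_add_of_nonneg _ _ (by linarith) (by linarith), sub_add_cancel]
  rw [eLpNorm_eq_lintegral_rpow_enorm_toReal (by simpa using hq0) ENNReal.ofReal_ne_top,
    ENNReal.toReal_ofReal hq0.le]
  refine (ENNReal.rpow_le_rpow key (by positivity)).trans (le_of_eq ?_)
  rw [← ENNReal.rpow_mul, mul_one_div_cancel hq0.ne', ENNReal.rpow_one]

variable (p : Fin N → Prop) [DecidablePred p]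

/-- The points whose projection onto the coordinates satisfying `p` has norm `s ≥ 1`, and whose
other projection has norm at most `c s ^ (-θ)`. -/
def arm (θ c : ℝ) : Set (Euc N) :=
  {x | 1 ≤ ‖proj p x‖ ∧ ‖proj (fun i => ¬ p i) x‖ ≤ c * ‖proj p x‖ ^ (-θ)}

/-- The dyadic pieces of `arm p θ c`. -/
def armPiece (θ c : ℝ) (j : ℕ) : Set (Euc N) :=
  {x | x ∈ arm p θ c ∧ 2 ^ j ≤ ‖proj p x‖ ∧ ‖proj p x‖ < 2 ^ (j + 1)}

variable {θ c : ℝ}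

lemma arm_subset_iUnion : arm p θ c ⊆ ⋃ j, armPiece p θ c j := by
  intro x hx
  obtain ⟨j, hj⟩ := exists_nat_pow_near hx.1 one_lt_two
  exact Set.mem_iUnion.2 ⟨j, hx, hj⟩

lemma armPiece_subset_box (hθ : 0 ≤ θ) (hc : 0 ≤ c) (j : ℕ) :
    armPiece p θ c j ⊆ box p (2 * 2 ^ j) (c * (2 ^ j) ^ (-θ)) := by
  rintro x ⟨hx, h1, h2⟩
  refine ⟨by rw [← pow_succ']; exact h2.le, hx.2.trans ?_⟩
  exact mul_le_mul_of_nonneg_left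
    (Real.rpow_le_rpow_of_nonpos (by positivity) h1 (neg_nonpos.2 hθ)) hc

/-- A negative exponent makes the dyadic bounds a geometric series of ratio `2 ^ e < 1`. -/
lemma setLIntegral_arm_le {e : ℝ} (he : e < 0) : ∃ K : ℝ≥0, ∀ (f : Euc N → ℝ≥0∞) (M : ℝ≥0∞),
    (∀ j, ∫⁻ x in armPiece p θ c j, f x ≤ ENNReal.ofReal ((2 ^ j) ^ e) * M) →
      ∫⁻ x in arm p θ c, f x ≤ K * M := by
  have h1 : ENNReal.ofReal (2 ^ e) < 1 := by
    rw [ENNReal.ofReal_lt_one]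
    exact Real.rpow_lt_one_of_one_lt_of_neg one_lt_two he
  have h2 : (1 - ENNReal.ofReal (2 ^ e))⁻¹ ≠ ∞ := by
    rw [ENNReal.inv_ne_top]
    exact (tsub_pos_of_lt h1).ne'
  refine ⟨(1 - ENNReal.ofReal (2 ^ e))⁻¹.toNNReal, fun f M h => ?_⟩
  calc ∫⁻ x in arm p θ c, f x ≤ ∫⁻ x in ⋃ j, armPiece p θ c j, f x :=
        lintegral_mono_set (arm_subset_iUnion p)
    _ ≤ ∑' j, ∫⁻ x in armPiece p θ c j, f x := lintegral_iUnion_le _ _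
    _ ≤ ∑' j, ENNReal.ofReal (2 ^ e) ^ j * M := by
        refine ENNReal.tsum_le_tsum fun j => (h j).trans (le_of_eq ?_)
        rw [← ENNReal.ofReal_pow (by positivity), Real.rpow_pow_comm zero_le_two]
    _ = _ := by
        rw [ENNReal.tsum_mul_right, ENNReal.tsum_geometric, ENNReal.coe_toNNReal h2]

lemma exists_volume_armPiece_le (hθ : 0 ≤ θ) (hc : 0 ≤ c) : ∃ C : ℝ≥0, ∀ j,
    volume (armPiece p θ c j) ≤ C * ENNReal.ofReal
      ((2 ^ j) ^ (Fintype.card {i // p i} - Fintype.card {i // ¬ p i} * θ)) := by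
  obtain ⟨C, hC⟩ := exists_volume_box_le p
  set k := Fintype.card {i // ¬ p i}
  set m := Fintype.card {i // p i}
  refine ⟨C * (2 ^ m * c ^ k).toNNReal, fun j => ?_⟩
  refine (measure_mono (armPiece_subset_box p hθ hc j)).trans
    ((hC _ _ (by positivity) (by positivity)).trans (le_of_eq ?_))
  have h2 : (0 : ℝ) < 2 ^ j := by positivity
  have : (2 * 2 ^ j) ^ m * (c * (2 ^ j) ^ (-θ)) ^ k =
      (2 ^ m * c ^ k) * ((2 : ℝ) ^ j) ^ (m - k * θ) := by
    rw [mul_pow, mul_pow, ← Real.rpow_mul_natCast h2.le, sub_eq_add_neg, Real.rpow_add h2,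
      Real.rpow_natCast, show -(k * θ) = -θ * k by ring]
    ring
  rw [this, ENNReal.ofReal_mul (by positivity)]
  push_cast [ENNReal.ofReal]
  ring

lemma exists_setLIntegral_armPiece_sq_le (hp : 1 ≤ Fintype.card {i // ¬ p i}) (hθ : 0 ≤ θ)
    (hc : 0 < c) : ∃ C : ℝ≥0, ∀ F : Sph N → ℂ, MemLp F 2 (sigma N) → ∀ j,
      ∫⁻ x in armPiece p θ c j, ‖rawExt F x‖ₑ ^ 2 ≤ C * ENNReal.ofReal ((2 ^ j) ^
        (loss (Fintype.card {i // ¬ p i}) - Fintype.card {i // ¬ p i} * θ)) *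
          eLpNorm F 2 (sigma N) ^ 2 := by
  obtain ⟨C, hC⟩ := exists_lintegral_box_rawExt_sq_le p hp
  set k := Fintype.card {i // ¬ p i}
  refine ⟨C * (2 ^ loss k * c ^ k).toNNReal, fun F hF j => ?_⟩
  have h1 : (1 : ℝ) ≤ 2 ^ j := one_le_pow₀ one_le_two
  have h2 : (0 : ℝ) < 2 ^ j := by positivity
  refine (lintegral_mono_set (armPiece_subset_box p hθ hc.le j)).trans
    ((hC F hF _ _ (by linarith) (by positivity)).trans (le_of_eq ?_))
  have : (2 * 2 ^ j) ^ loss k * (c * (2 ^ j) ^ (-θ)) ^ k =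
      (2 ^ loss k * c ^ k) * ((2 : ℝ) ^ j) ^ (loss k - k * θ) := by
    rw [Real.mul_rpow zero_le_two h2.le, mul_pow, ← Real.rpow_mul_natCast h2.le, sub_eq_add_neg,
      Real.rpow_add h2, show -(k * θ) = -θ * k by ring]
    ring
  rw [this, ENNReal.ofReal_mul (by positivity)]
  push_cast [ENNReal.ofReal]
  ring

/-- The estimate on an arm of finite volume. -/
lemma extensionEstimate_arm_of_lt (hθ : 0 ≤ θ) (hc : 0 ≤ c) (hq : 0 ≤ q)
    (h : (Fintype.card {i // p i} : ℝ) < Fintype.card {i // ¬ p i} * θ) :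
    ExtensionEstimate G (arm p θ c) q := by
  refine extensionEstimate_of_volume_ne_top ?_ hq
  obtain ⟨C, hC⟩ := exists_volume_armPiece_le p hθ hc
  obtain ⟨K, hK⟩ := setLIntegral_arm_le p (θ := θ) (c := c) (sub_neg.2 h)
  -- With integrand 1 the dyadic summation computes the volume of the arm.
  have := hK 1 C fun j => by simpa [mul_comm] using hC j
  simp only [Pi.one_apply, setLIntegral_one] at this
  exact ne_top_of_le_ne_top (by finiteness) this

/-- The estimate on an arm for exponents `q ≤ 2`, by Hölder's inequality. -/
lemma extensionEstimate_arm_of_le_two (hp : 1 ≤ Fintype.card {i // ¬ p i}) (hθ : 0 ≤ θ)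
    (hc : 0 < c) (hq : 0 < q) (hq2 : q ≤ 2)
    (h : 2 * (Fintype.card {i // p i} - Fintype.card {i // ¬ p i} * θ) <
      q * (Fintype.card {i // p i} - loss (Fintype.card {i // ¬ p i}))) :
    ExtensionEstimate G (arm p θ c) q := by
  obtain ⟨C, hC⟩ := exists_volume_armPiece_le p hθ hc.le
  obtain ⟨D, hD⟩ := exists_setLIntegral_armPiece_sq_le p hp hθ hc
  set k := Fintype.card {i // ¬ p i}
  set m := Fintype.card {i // p i}
  -- Hölder's interpolation between the square integral and the volume of a piece; the hypothesis
  -- `h` says exactly that `e < 0`.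
  set e := (loss k - k * θ) * (q / 2) + (m - k * θ) * (1 - q / 2) with he
  obtain ⟨K, hK⟩ := setLIntegral_arm_le p (θ := θ) (c := c) (e := e) (by linarith)
  have hq1 : 0 ≤ q / 2 := by linarith
  have hq3 : 0 ≤ 1 - q / 2 := by linarith
  refine ⟨K * (D ^ (q / 2) * C ^ (1 - q / 2)), fun F hF _ => ?_⟩
  push_cast
  rw [mul_assoc]
  refine hK _ _ fun j => ?_
  have h2 : (0 : ℝ) < 2 ^ j := by positivity
  calc ∫⁻ x in armPiece p θ c j, ‖rawExt F x‖ₑ ^ q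
      ≤ (∫⁻ x in armPiece p θ c j, ‖rawExt F x‖ₑ ^ 2) ^ (q / 2) *
          volume (armPiece p θ c j) ^ (1 - q / 2) := by
        simpa using rpow_lintegral_rpow_le (μ := volume.restrict (armPiece p θ c j))
          (continuous_rawExt hF).enorm.measurable.aemeasurable hq hq2
    _ ≤ (D * ENNReal.ofReal ((2 ^ j) ^ (loss k - k * θ)) * eLpNorm F 2 (sigma N) ^ 2) ^ (q / 2) *
          (C * ENNReal.ofReal ((2 ^ j) ^ (m - k * θ))) ^ (1 - q / 2) := by
        gcongr
        · exact hD F hF j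
        · exact hC j
    _ = _ := by
        rw [ENNReal.mul_rpow_of_nonneg _ _ hq1, ENNReal.mul_rpow_of_nonneg _ _ hq1,
          ENNReal.mul_rpow_of_nonneg _ _ hq3, ENNReal.ofReal_rpow_of_pos (by positivity),
          ENNReal.ofReal_rpow_of_pos (by positivity), ← Real.rpow_mul h2.le, ← Real.rpow_mul h2.le,
          he, Real.rpow_add h2, ENNReal.ofReal_mul (by positivity), ← ENNReal.rpow_ofNat,
          ← ENNReal.rpow_mul, ENNReal.coe_rpow_of_nonneg _ hq1, ENNReal.coe_rpow_of_nonneg _ hq3,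
          mul_div_cancel₀ q two_ne_zero]
        ring

/-- The estimate on an arm for exponents `q ≥ 2`, by the pointwise decay of the extension. -/
lemma extensionEstimate_arm_of_two_le (hp : 1 ≤ Fintype.card {i // p i})
    (hp' : 1 ≤ Fintype.card {i // ¬ p i})
    (hG : ∀ A : Matrix.orthogonalGroup (Fin N) ℝ, (∀ i j : Fin N, ¬(p i ↔ p j) →
      (A : Matrix (Fin N) (Fin N) ℝ) i j = 0) → A ∈ G) (hθ : 0 ≤ θ) (hc : 0 < c) (hq2 : 2 ≤ q)
    (hm : loss (Fintype.card {i // ¬ p i}) ≤ Fintype.card {i // p i} - 1)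
    (h : loss (Fintype.card {i // ¬ p i}) - Fintype.card {i // ¬ p i} * θ <
      (Fintype.card {i // p i} - 1 - loss (Fintype.card {i // ¬ p i})) * ((q - 2) / 2)) :
    ExtensionEstimate G (arm p θ c) q := by
  obtain ⟨C, hC⟩ := exists_enorm_rawExt_sq_le_rpow p hp hp' hG c
  obtain ⟨D, hD⟩ := exists_setLIntegral_armPiece_sq_le p hp' hθ hc
  set k := Fintype.card {i // ¬ p i}
  set m := Fintype.card {i // p i}
  set d := loss k - (m - 1) with hd
  -- Pointwise decay is applied to the power `q - 2`, and the square integral over the piece takes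
  -- the remaining power 2.
  set e := d * ((q - 2) / 2) + (loss k - k * θ) with he
  obtain ⟨K, hK⟩ := setLIntegral_arm_le p (θ := θ) (c := c) (e := e) (by
    rw [he, hd]; linarith)
  have hq3 : 0 ≤ (q - 2) / 2 := by linarith
  refine ⟨K * (C ^ ((q - 2) / 2) * D), fun F hF hinv => ?_⟩
  push_cast
  rw [mul_assoc]
  refine hK _ _ fun j => ?_
  have h2 : (0 : ℝ) < 2 ^ j := by positivity
  set M := eLpNorm F 2 (sigma N) with hM
  have hMt : M ≠ ∞ := hF.2.ne
  have hpt : ∀ x ∈ armPiece p θ c j, ‖rawExt F x‖ₑ ^ q ≤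
      (C * ENNReal.ofReal ((2 ^ j) ^ d) * M ^ 2) ^ ((q - 2) / 2) * ‖rawExt F x‖ₑ ^ 2 := by
    rintro x ⟨hx, hx1, hx2⟩
    have hxc : ‖proj (fun i => ¬ p i) x‖ ≤ c := hx.2.trans
      (mul_le_of_le_one_right hc.le (Real.rpow_le_one_of_one_le_of_nonpos hx.1 (by linarith)))
    calc ‖rawExt F x‖ₑ ^ q = (‖rawExt F x‖ₑ ^ 2) ^ ((q - 2) / 2) * ‖rawExt F x‖ₑ ^ 2 := by
          rw [← ENNReal.rpow_ofNat, ← ENNReal.rpow_mul,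
            ← ENNReal.rpow_add_of_nonneg _ _ (by linarith) (by norm_num)]
          congr 1
          ring
      _ ≤ _ := by
          gcongr
          refine (hC F hF hinv x hx.1 hxc).trans ?_
          exact mul_le_mul_left (mul_le_mul_right (ENNReal.ofReal_le_ofReal
            (Real.rpow_le_rpow_of_nonpos h2 hx1 (sub_nonpos.2 hm))) _) _
  calc ∫⁻ x in armPiece p θ c j, ‖rawExt F x‖ₑ ^ q
      ≤ ∫⁻ x in armPiece p θ c j,
          (C * ENNReal.ofReal ((2 ^ j) ^ d) * M ^ 2) ^ ((q - 2) / 2) * ‖rawExt F x‖ₑ ^ 2 :=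
        setLIntegral_mono ((continuous_rawExt hF).enorm.measurable.pow_const 2 |>.const_mul _) hpt
    _ = (C * ENNReal.ofReal ((2 ^ j) ^ d) * M ^ 2) ^ ((q - 2) / 2) *
          ∫⁻ x in armPiece p θ c j, ‖rawExt F x‖ₑ ^ 2 :=
        lintegral_const_mul' _ _ (by finiteness)
    _ ≤ (C * ENNReal.ofReal ((2 ^ j) ^ d) * M ^ 2) ^ ((q - 2) / 2) *
          (D * ENNReal.ofReal ((2 ^ j) ^ (loss k - k * θ)) * M ^ 2) := by
        gcongr
        exact hD F hF j
    _ = _ := by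
        have hMq : M ^ q = M ^ (q - 2) * M ^ 2 := by
          rw [← ENNReal.rpow_ofNat, ← ENNReal.rpow_add_of_nonneg _ _ (by linarith) (by norm_num)]
          congr 1
          ring
        rw [ENNReal.mul_rpow_of_nonneg _ _ hq3, ENNReal.mul_rpow_of_nonneg _ _ hq3,
          ENNReal.ofReal_rpow_of_pos (by positivity), ← Real.rpow_mul h2.le, he, Real.rpow_add h2,
          ENNReal.ofReal_mul (by positivity), hMq, ENNReal.coe_rpow_of_nonneg _ hq3]
        nth_rw 1 [← ENNReal.rpow_ofNat]
        rw [← ENNReal.rpow_mul, mul_div_cancel₀ _ two_ne_zero]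
        ring

end Arm

/-! ### The two families of coordinates -/

section Blocks

variable {N k : ℕ}

lemma headNorm_eq (x : Euc N) : headNorm N k x = ‖proj (fun i : Fin N => i.val < N - k) x‖ := by
  rw [headNorm, ← norm_proj_sq, Real.sqrt_sq (norm_nonneg _)]

lemma tailNorm_eq (x : Euc N) : tailNorm N k x = ‖proj (fun i : Fin N => N - k ≤ i.val) x‖ := by
  rw [tailNorm, ← norm_proj_sq, Real.sqrt_sq (norm_nonneg _)]

lemma tailNorm_eq' (x : Euc N) :
    tailNorm N k x = ‖proj (fun i : Fin N => ¬ i.val < N - k) x‖ := by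
  simp_rw [tailNorm, ← not_lt]
  rw [← norm_proj_sq, Real.sqrt_sq (norm_nonneg _)]

lemma headNorm_eq' (x : Euc N) :
    headNorm N k x = ‖proj (fun i : Fin N => ¬ N - k ≤ i.val) x‖ := by
  simp_rw [headNorm, ← not_le]
  rw [← norm_proj_sq, Real.sqrt_sq (norm_nonneg _)]

lemma card_head : Fintype.card {i : Fin N // i.val < N - k} = N - k := by
  rw [Fintype.card_subtype, Fin.card_filter_val_lt]
  omega

lemma card_not_tail : Fintype.card {i : Fin N // ¬ N - k ≤ i.val} = N - k := by
  simp_rw [not_le]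
  exact card_head

lemma card_not_head (hk : k ≤ N) : Fintype.card {i : Fin N // ¬ i.val < N - k} = k := by
  rw [Fintype.card_subtype_compl, card_head, Fintype.card_fin]
  omega

lemma card_tail (hk : k ≤ N) : Fintype.card {i : Fin N // N - k ≤ i.val} = k := by
  simp_rw [← not_lt]
  exact card_not_head hk

lemma mem_blockGroup_of_head (A : Matrix.orthogonalGroup (Fin N) ℝ)
    (hA : ∀ i j : Fin N, ¬(i.val < N - k ↔ j.val < N - k) →
      (A : Matrix (Fin N) (Fin N) ℝ) i j = 0) : A ∈ blockGroup N k := hA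

lemma mem_blockGroup_of_tail (A : Matrix.orthogonalGroup (Fin N) ℝ)
    (hA : ∀ i j : Fin N, ¬(N - k ≤ i.val ↔ N - k ≤ j.val) →
      (A : Matrix (Fin N) (Fin N) ℝ) i j = 0) : A ∈ blockGroup N k :=
  fun i j hij => hA i j (by rwa [← not_lt, ← not_lt, not_iff_not])

/-- The maximum is `t ^ (-β)` for `t ≥ 1` and `t ^ (-α)` for `t ≤ 1`. In the second case solving `s
≤ a * t ^ (-α)` for `t` exchanges the roles of the blocks and gives the exponent `1 / α`. -/
lemma L_subset {α β a : ℝ} (hβ : 0 < β) (hαβ : β ≤ α) (ha : 0 < a) :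
    L N k α β a ⊆ box (fun i : Fin N => i.val < N - k) 1 1 ∪
      (arm (fun i : Fin N => i.val < N - k) (1 / α) (a ^ (1 / α)) ∪
        arm (fun i : Fin N => N - k ≤ i.val) β a) := by
  intro x hx
  have hα : 0 < α := hβ.trans_le hαβ
  simp only [L, Set.mem_ofPred_eq] at hx
  simp only [box, arm, Set.mem_union, Set.mem_ofPred_eq, ← headNorm_eq, ← tailNorm_eq,
    ← headNorm_eq', ← tailNorm_eq']
  have hs0 : 0 ≤ headNorm N k x := Real.sqrt_nonneg _
  have ht0 : 0 ≤ tailNorm N k x := Real.sqrt_nonneg _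
  set s := headNorm N k x
  set t := tailNorm N k x
  rcases ht0.eq_or_lt with ht | ht
  · rw [← ht]
    rcases le_total s 1 with h | h
    · exact Or.inl ⟨h, zero_le_one⟩
    · exact Or.inr (Or.inl ⟨h, by positivity⟩)
  replace hx := hx.resolve_left ht.ne'
  rcases le_total 1 t with h1 | h1
  · refine Or.inr (Or.inr ⟨h1, ?_⟩)
    rwa [max_eq_right (Real.rpow_le_rpow_of_exponent_le h1 (neg_le_neg hαβ))] at hx
  rw [max_eq_left (Real.rpow_le_rpow_of_exponent_ge ht h1 (neg_le_neg hαβ))] at hx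
  rcases le_total s 1 with h | h
  · exact Or.inl ⟨h, h1⟩
  refine Or.inr (Or.inl ⟨h, ?_⟩)
  have hs : 0 < s := by linarith
  have h2 : t ^ α ≤ a * s⁻¹ := by
    rw [Real.rpow_neg ht.le, ← div_eq_mul_inv, le_div_iff₀ (by positivity)] at hx
    rw [← div_eq_mul_inv, le_div_iff₀ hs, mul_comm]
    exact hx
  have h3 := Real.rpow_le_rpow (by positivity) h2 (by positivity : 0 ≤ 1 / α)
  rwa [← Real.rpow_mul ht.le, mul_one_div_cancel hα.ne', Real.rpow_one,
    Real.mul_rpow ha.le (by positivity), Real.inv_rpow hs.le, ← Real.rpow_neg hs.le] at h3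

end Blocks

/-! ### The extension estimate -/

section Estimate

variable {N : ℕ} (p : Fin N → Prop) [DecidablePred p] {θ c q : ℝ}
  {G : Subgroup (Matrix.orthogonalGroup (Fin N) ℝ)}

lemma extensionEstimate_box (hq : 0 ≤ q) : ExtensionEstimate G (box p 1 1) q := by
  obtain ⟨C, hC⟩ := exists_volume_box_le p
  exact extensionEstimate_of_volume_ne_top
    (ne_top_of_le_ne_top (by finiteness) (hC 1 1 zero_le_one zero_le_one)) hq

lemma extensionEstimate_arm_of_two_le_card (hp : 2 ≤ Fintype.card {i // ¬ p i}) (hθ : 0 ≤ θ)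
    (hc : 0 < c) (hq : 0 < q) (hq2 : q ≤ 2)
    (h : 2 * (Fintype.card {i // p i} - Fintype.card {i // ¬ p i} * θ) <
      q * Fintype.card {i // p i}) : ExtensionEstimate G (arm p θ c) q := by
  refine extensionEstimate_arm_of_le_two p (by omega) hθ hc hq hq2 ?_
  rwa [loss, if_neg (by omega), sub_zero]

/-- With one short direction the loss is `1 / 2`, and the critical exponent may lie on either side
of 2, so both arm estimates occur. Equality is allowed in `h`, since strictness comes from `q > 0`
in one case and `θ > 0` in the other. -/
lemma extensionEstimate_arm_of_card_eq_one (hp : 2 ≤ Fintype.card {i // p i})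
    (hp' : Fintype.card {i // ¬ p i} = 1)
    (hG : ∀ A : Matrix.orthogonalGroup (Fin N) ℝ, (∀ i j : Fin N, ¬(p i ↔ p j) →
      (A : Matrix (Fin N) (Fin N) ℝ) i j = 0) → A ∈ G) (hθ : 0 < θ) (hc : 0 < c) (hq : 1 ≤ q)
    (h : 2 * Fintype.card {i // p i} - 2 * θ ≤ q * (Fintype.card {i // p i} - 1)) :
    ExtensionEstimate G (arm p θ c) q := by
  have hm : (2 : ℝ) ≤ Fintype.card {i // p i} := by exact_mod_cast hp
  have hl : loss 1 = 1 / 2 := if_pos rfl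
  rcases le_total q 2 with hq2 | hq2
  · refine extensionEstimate_arm_of_le_two p hp'.ge hθ.le hc (by linarith) hq2 ?_
    rw [hp', hl, Nat.cast_one]
    linarith
  · refine extensionEstimate_arm_of_two_le p (by omega) hp'.ge hG hθ.le hc hq2 ?_ ?_
    · rw [hp', hl]
      linarith
    · rw [hp', hl, Nat.cast_one]
      -- Adding `h` to `(m - 2) * (q - 2) ≥ 0` bounds the right-hand side below by `(1 - θ) / 2`,
      -- which exceeds `1 / 2 - θ`.
      nlinarith [mul_nonneg (sub_nonneg.2 hm) (sub_nonneg.2 hq2)]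

/-- The condition coming from `lam` has `m - 1` where the arm estimate needs only `m`. This slack
gives strictness at the critical exponent, and lowering the exponent to 2 is harmless because `κ >
0`. -/
lemma lt_mul_of_le_mul_sub_one {m κ q₀ : ℝ} (hκ : 0 < κ) (hq : 1 ≤ q)
    (h : 2 * m - 2 * κ ≤ q * (m - 1)) (hq₀ : q₀ = min 2 q) : 2 * (m - κ) < q₀ * m := by
  rcases min_choice 2 q with h' | h' <;> rw [hq₀, h'] <;> nlinarith

theorem exists_extension_estimate {N k : ℕ} (hN : 3 ≤ N) (hk : 1 ≤ k) (hkN : k < N) {α β a : ℝ}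
    (hβ : 0 < β) (hαβ : β ≤ α) (ha : 0 < a) :
    ∃ C : ℝ≥0, ∀ q : ℝ, 1 ≤ q → ExponentCondition N k α β q → ∀ F : Sph N → ℂ,
      MemLp F 2 (sigma N) → IsInvariant (blockGroup N k) F →
        eLpNorm ((L N k α β a).indicator (extension F)) (ENNReal.ofReal q) volume ≤
          C * eLpNorm F 2 (sigma N) := by
  have hα : 0 < α := hβ.trans_le hαβ
  have hα' : 0 < 1 / α := by positivity
  have haα : 0 < a ^ (1 / α) := by positivity
  have hN' : (3 : ℝ) ≤ N := by exact_mod_cast hN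
  have hNk : ((N - k : ℕ) : ℝ) = N - k := Nat.cast_sub hkN.le
  have hk0 : (1 : ℝ) ≤ k := by exact_mod_cast hk
  have hNk0 : (k : ℝ) + 1 ≤ N := by exact_mod_cast hkN
  -- A single exponent below all admissible ones suffices, which makes the constant uniform in `q`.
  -- If no exponent is admissible, there is nothing to prove.
  suffices h : (∃ q, ExponentCondition N k α β q) → ∃ q₀ : ℝ, 1 ≤ q₀ ∧
      (∀ q, 1 ≤ q → ExponentCondition N k α β q → q₀ ≤ q) ∧
      ExtensionEstimate (blockGroup N k)
        (arm (fun i : Fin N => i.val < N - k) (1 / α) (a ^ (1 / α))) q₀ ∧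
      ExtensionEstimate (blockGroup N k) (arm (fun i : Fin N => N - k ≤ i.val) β a) q₀ by
    by_cases hq : ∃ q, ExponentCondition N k α β q
    · obtain ⟨q₀, hq₀, hle, hhead, htail⟩ := h hq
      have hL : ExtensionEstimate (blockGroup N k) (L N k α β a) q₀ :=
        ((extensionEstimate_box _ (by linarith)).union (hhead.union htail)).mono
          (L_subset hβ hαβ ha)
      obtain ⟨C, hC⟩ := hL.exists_eLpNorm_indicator_le hq₀
      exact ⟨C, fun q hq1 hq => hC q (hle q hq1 hq)⟩
    · exact ⟨0, fun q _ hq' => absurd ⟨q, hq'⟩ hq⟩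
  rintro ⟨q', hq'⟩
  rcases hq' with ⟨rfl, hβ', -⟩ | ⟨hk2, hkN2, -⟩ | ⟨rfl, hα'', -⟩
  · have hN2 : (0 : ℝ) < N - 2 := by linarith
    refine ⟨max 1 ((2 * ((N : ℝ) - 1) - 2 / α) / (N - 2)), le_max_left _ _, ?_, ?_, ?_⟩
    · rintro q hq (⟨-, -, h⟩ | ⟨h, -⟩ | ⟨h, -⟩)
      · exact max_le hq h.le
      · omega
      · omega
    · refine extensionEstimate_arm_of_card_eq_one _ (by rw [card_head]; omega)
        (card_not_head hkN.le) mem_blockGroup_of_head hα' haα (le_max_left _ _) ?_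
      rw [card_head, hNk, Nat.cast_one]
      have := (div_le_iff₀ hN2).1 (le_max_right 1 ((2 * ((N : ℝ) - 1) - 2 / α) / (N - 2)))
      rw [mul_one_div]
      linarith
    -- This arm has one long direction and `N - 1` short ones; `β > 1 / (N - 1)` makes its volume
    -- finite.
    · refine extensionEstimate_arm_of_lt _ hβ.le ha.le (le_trans zero_le_one (le_max_left _ _)) ?_
      rw [card_tail hkN.le, card_not_tail, hNk, Nat.cast_one]
      rwa [div_lt_iff₀' (by linarith)] at hβ'
  · have hk2' : (2 : ℝ) ≤ k := by exact_mod_cast hk2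
    have hkN2' : (k : ℝ) + 2 ≤ N := by exact_mod_cast hkN2
    have h1 : 1 ≤ max 1 (lam N k α β) := le_max_left _ _
    have h2 : (2 * k - 2 * β * (N - k)) / (k - 1) ≤ max 1 (lam N k α β) :=
      (le_max_left _ _).trans (le_max_right _ _)
    have h3 : (2 * (N - k) - 2 * k / α) / (N - k - 1) ≤ max 1 (lam N k α β) :=
      (le_max_right _ _).trans (le_max_right _ _)
    rw [div_le_iff₀ (by linarith)] at h2 h3
    have hq₀ : 1 ≤ min 2 (max 1 (lam N k α β)) := le_min one_le_two h1
    -- Both blocks have dimension at least 2, so there is no loss and the square integral with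
    -- Hölder suffices. The cap at 2 keeps the exponent in Hölder's range.
    refine ⟨min 2 (max 1 (lam N k α β)), hq₀, ?_, ?_, ?_⟩
    · rintro q hq (⟨h, -⟩ | ⟨-, -, h⟩ | ⟨h, -⟩)
      · omega
      · exact (min_le_right _ _).trans (max_le hq h.le)
      · omega
    · refine extensionEstimate_arm_of_two_le_card _ (by rwa [card_not_head hkN.le]) hα'.le haα
        (by linarith) (min_le_left _ _) ?_
      rw [card_head, card_not_head hkN.le, hNk]
      refine lt_mul_of_le_mul_sub_one (by positivity) h1 ?_ rfl
      rw [mul_one_div, ← mul_div_assoc]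
      exact h3
    · refine extensionEstimate_arm_of_two_le_card _ (by rw [card_not_tail]; omega) hβ.le ha
        (by linarith) (min_le_left _ _) ?_
      rw [card_tail hkN.le, card_not_tail, hNk]
      refine lt_mul_of_le_mul_sub_one (mul_pos (by linarith) hβ) h1 ?_ rfl
      linarith
  · push_cast at hN' hNk ⊢
    push_cast at hα''
    have hN2 : (0 : ℝ) < k + 1 - 2 := by linarith
    refine ⟨max 1 ((2 * ((k : ℝ) + 1 - 1) - 2 * β) / (k + 1 - 2)), le_max_left _ _, ?_, ?_, ?_⟩
    · rintro q hq (⟨h, -⟩ | ⟨-, h, -⟩ | ⟨-, -, h⟩)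
      · omega
      · omega
      · push_cast at h
        exact max_le hq h.le
    -- The mirror case: one long direction, with finite volume because `α < N - 1`.
    · refine extensionEstimate_arm_of_lt _ hα'.le haα.le
        (le_trans zero_le_one (le_max_left _ _)) ?_
      rw [card_head, card_not_head hkN.le, hNk, mul_one_div, lt_div_iff₀ hα]
      linarith
    · refine extensionEstimate_arm_of_card_eq_one _ (by rw [card_tail hkN.le]; omega)
        (by rw [card_not_tail]; omega) mem_blockGroup_of_tail hβ ha (le_max_left _ _) ?_
      rw [card_tail hkN.le]
      have := (div_le_iff₀ hN2).1 (le_max_right 1 ((2 * ((k : ℝ) + 1 - 1) - 2 * β) / (k + 1 - 2)))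
      linarith

end Estimate

/-! ### Admissible exponents -/

/-- For this ratio both numerators in `lam` vanish, so the threshold is 0. -/
lemma exponentCondition_div {N k : ℕ} (hk : 2 ≤ k) (hkN : k + 2 ≤ N) {q : ℝ} (hq : 1 ≤ q) :
    ExponentCondition N k ((k : ℝ) / (N - k)) ((k : ℝ) / (N - k)) q := by
  have hk' : (2 : ℝ) ≤ k := by exact_mod_cast hk
  have hkN' : (k : ℝ) + 2 ≤ N := by exact_mod_cast hkN
  have h0 : (N : ℝ) - k ≠ 0 := by linarith
  have hk0 : (k : ℝ) ≠ 0 := by linarith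
  refine Or.inr (Or.inl ⟨hk, hkN, ?_⟩)
  have h1 : 2 * (k : ℝ) - 2 * (k / (N - k)) * (N - k) = 0 := by field_simp; ring
  have h2 : 2 * ((N : ℝ) - k) - 2 * k / (k / (N - k)) = 0 := by field_simp; ring
  rw [lam, h1, h2, zero_div, zero_div, max_self]
  linarith

lemma exists_exponentCondition_lt {N k : ℕ} (hN : 3 ≤ N) (hk : 1 ≤ k) (hkN : k < N) {α : ℝ}
    (hα : 0 < α) (h1 : (N : ℝ) + 1 - 2 * k < α * ((N - k) * (N - 1)))
    (h2 : α * (2 * k - (N - 1)) < k * ((N : ℝ) - 1)) :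
    ∃ q : ℝ, 1 ≤ q ∧ q < 2 * ((N : ℝ) + 1) / (N - 1) ∧ ExponentCondition N k α α q := by
  have hN' : (3 : ℝ) ≤ N := by exact_mod_cast hN
  have hk' : (1 : ℝ) ≤ k := by exact_mod_cast hk
  have hkN' : (k : ℝ) + 1 ≤ N := by exact_mod_cast hkN
  have hN1 : (0 : ℝ) < N - 1 := by linarith
  have hST : 1 < 2 * ((N : ℝ) + 1) / (N - 1) := by
    rw [lt_div_iff₀ hN1]; linarith
  -- After clearing denominators this is `h2`, by `(N - k)(N - 1) - (N + 1)(N - k - 1) = 2k - (N -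
  -- 1)`.
  have hhead : (k : ℝ) + 2 ≤ N ∨ (k : ℝ) = 1 →
      (2 * ((N : ℝ) - k) - 2 * k / α) / (N - k - 1) < 2 * ((N : ℝ) + 1) / (N - 1) := by
    intro h
    have h0 : (0 : ℝ) < N - k - 1 := by rcases h with h | h <;> linarith
    rw [div_lt_div_iff₀ h0 hN1]
    have h3 : (2 * k - (N - 1)) < k * ((N : ℝ) - 1) / α := by
      rwa [lt_div_iff₀ hα, mul_comm]
    have h4 : (2 * ((N : ℝ) - k) - 2 * k / α) * (N - 1) =
        2 * (N - k) * (N - 1) - 2 * (k * (N - 1) / α) := by ring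
    rw [h4]
    nlinarith
  -- Likewise this is `h1`, by `k(N - 1) - (N + 1)(k - 1) = N + 1 - 2k`.
  have htail : (2 : ℝ) ≤ k →
      (2 * (k : ℝ) - 2 * α * (N - k)) / (k - 1) < 2 * ((N : ℝ) + 1) / (N - 1) := by
    intro h
    rw [div_lt_div_iff₀ (by linarith) hN1]
    nlinarith
  suffices h : ∃ X : ℝ, X < 2 * ((N : ℝ) + 1) / (N - 1) ∧
      ∀ q, X < q → ExponentCondition N k α α q by
    obtain ⟨X, hX, hq⟩ := h
    obtain ⟨q, hq1, hq2⟩ := exists_between (max_lt hST hX)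
    exact ⟨q, (le_max_left _ _).trans hq1.le, hq2, hq q ((le_max_right _ _).trans_lt hq1)⟩
  rcases (by omega : k = 1 ∨ (2 ≤ k ∧ k + 2 ≤ N) ∨ k + 1 = N) with rfl | ⟨hk2, hkN2⟩ | rfl
  · rw [Nat.cast_one] at *
    refine ⟨(2 * ((N : ℝ) - 1) - 2 / α) / (N - 2), ?_, fun q hq => Or.inl ⟨rfl, ?_, hq⟩⟩
    · have := hhead (Or.inr rfl)
      rwa [mul_one, sub_sub, one_add_one_eq_two] at this
    -- For `k = 1` the hypothesis `h1` reads `N - 1 < α (N - 1)²`, which is the required lower bound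
    -- on `α`. For `k = N - 1`, `h2` gives `α < N - 1` in the same way.
    · rw [div_lt_iff₀ hN1]
      nlinarith
  · exact ⟨lam N k α α, max_lt (htail (by exact_mod_cast hk2))
      (hhead (Or.inl (by exact_mod_cast hkN2))), fun q hq => Or.inr (Or.inl ⟨hk2, hkN2, hq⟩)⟩
  · refine ⟨_, htail ?_, fun q hq => Or.inr (Or.inr ⟨rfl, ?_, ?_⟩)⟩
    · push_cast at hN'
      linarith
    · push_cast at *
      nlinarith
    · push_cast at *
      convert hq using 2 <;> ring

end FourierExt
end

theorem theorem2p2 (N k : ℕ) (hN : 3 ≤ N) (hk : 1 ≤ k) (hkN : k < N) :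
    -- the extension estimate
    (∀ α β a : ℝ, 0 < β → β ≤ α → 0 < a →
      ∃ C : NNReal, ∀ q : ℝ, 1 ≤ q → FourierExt.ExponentCondition N k α β q →
        ∀ F : FourierExt.Sph N → ℂ, MemLp F 2 (FourierExt.sigma N) →
          FourierExt.IsInvariant (FourierExt.blockGroup N k) F →
          eLpNorm ((FourierExt.L N k α β a).indicator (FourierExt.extension F))
              (ENNReal.ofReal q) volume
            ≤ C * eLpNorm F 2 (FourierExt.sigma N)) ∧
    -- every `q ≥ 1` is allowed if `α = β = k / (N - k)` and `2 ≤ k ≤ N - 2`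
    (2 ≤ k → k + 2 ≤ N → ∀ q : ℝ, 1 ≤ q →
      FourierExt.ExponentCondition N k ((k : ℝ) / (N - k)) ((k : ℝ) / (N - k)) q) ∧
    -- exponents below the Stein--Tomas exponent are allowed
    (∀ α : ℝ, 0 < α → (N : ℝ) + 1 - 2 * k < α * ((N - k) * (N - 1)) →
      α * (2 * k - (N - 1)) < k * ((N : ℝ) - 1) →
      ∃ q : ℝ, 1 ≤ q ∧ q < 2 * ((N : ℝ) + 1) / (N - 1) ∧
        FourierExt.ExponentCondition N k α α q) :=
  ⟨fun _ _ _ hβ hαβ ha => FourierExt.exists_extension_estimate hN hk hkN hβ hαβ ha,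
    fun hk2 hkN2 _ hq => FourierExt.exponentCondition_div hk2 hkN2 hq,
    fun _ hα h1 h2 => FourierExt.exists_exponentCondition_lt hN hk hkN hα h1 h2⟩
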